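/- Let $X$ be a compact Polish space with a $C^\infty$ foliated structure of dimension $n\ge 0$: $X$ is covered by foliated charts $\xi_i:U_i\to B_i\times T_i$ (homeomorphisms, with $U_i\subset X$ open, $B_i\subset\mathbb R^n$ open and contractible, $T_i$ a space), intersections of plaques (the fibres of the projections $p_i:U_i\to T_i$) are open in the plaques, and the $\mathbb R^n$-component of each change of coordinates has partial derivatives of all orders in the $\mathbb R^n$-variable that are continuous in all variables. The leaves are the connected components of $X$ in the leaf topology, generated by the open subsets of the plaques. Write $I=[0,1]$. Let $L$ be a leaf of $X$ and let $D\subset L$ be a relatively compact regular domain (a connected subset of codimension zero with $C^\infty$ boundary in $L$, whose boundary points may or may not belong to $D$). Suppose that $D$ is without holonomy: every loop in $D$ has trivial holonomy germ. Let $c:I\to D$ be a $C^\infty$ path. Then, for any open neighbourhood $U$ of $c(I)$ in $X$, there is a $C^\infty$ leafwise diffeotopy $\phi:X\times I\to X$, supported in $U$, such that $$\phi(c(0),t)=c(t)\qquad\text{for all }t\in I .$$ Here a $C^\infty$ leafwise diffeotopy is a continuous map $\phi:X\times I\to X$ such that: $\phi(\cdot,0)=\mathrm{id}_X$; for each leaf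 $L'$, the set $\phi(L'\times I)$ is contained in a leaf; in foliated charts, the leafwise component of $\phi$ has derivatives of all orders in the leafwise variables and $t$ (one-sided in $t$ at $0$ and $1$), which are continuous in all variables; and every $\phi(\cdot,t)$ is a $C^\infty$ foliated diffeomorphism of $X$ (a bijection mapping leaves into leaves and leafwise $C^\infty$, as is its inverse). It is supported in $U$ when the closure in $X$ of $\{x\in X:\phi(x,t)\ne x\text{ for some }t\in I\}$ is contained in $U$. -/

import Mathlib

open Set Filter
open scoped Topology unitInterval ContDiff

universe u v

noncomputable section

/-- A map `g` of two variables `(a, y)`, with `a` in a finite-dimensional space and `y` in a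
topological space, is leafwise `C^∞` on `V` when all derivatives of all orders with respect to `a`
exist and are continuous on `V` as functions of the pair `(a, y)`. The set `V` is meant to be
relatively open in `S × Y`. The derivatives are taken within `S`: `S = univ` is the case without
boundary, and `S = ℝⁿ × [0, 1]` is the case with a time parameter, where derivatives at times `0`
and `1` are one-sided. -/
def LeafwiseSmoothOn {A G Y : Type*} [NormedAddCommGroup A] [NormedSpace ℝ A]
    [NormedAddCommGroup G] [NormedSpace ℝ G] [TopologicalSpace Y]
    (S : Set A) (g : A × Y → G) (V : Set (A × Y)) : Prop :=
  (∀ p ∈ V, ContDiffWithinAt ℝ ∞ (fun a => g (a, p.2)) S p.1) ∧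
    ∀ k : ℕ, ContinuousOn
      (fun p : A × Y => iteratedFDerivWithin ℝ k (fun a => g (a, p.2)) S p.1) V

/-- A foliated chart: a homeomorphism from an open subset `source` of `X` onto `B × T`, where `B`
is a contractible open subset of `ℝⁿ` and `T` is a topological space. -/
structure FoliatedChart (X : Type u) [TopologicalSpace X] (n : ℕ) where
  T : Type u
  [topT : TopologicalSpace T]
  B : Set (EuclideanSpace ℝ (Fin n))
  isOpen_B : IsOpen B
  contractible_B : ContractibleSpace B
  toHomeo : OpenPartialHomeomorph X (EuclideanSpace ℝ (Fin n) × T)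
  target_eq : toHomeo.target = B ×ˢ univ

attribute [instance] FoliatedChart.topT

namespace FoliatedChart

variable {X : Type u} [TopologicalSpace X] {n : ℕ}

/-- The open domain of the chart. -/
def source (e : FoliatedChart X n) : Set X := e.toHomeo.source

/-- The leafwise coordinates. -/
def coord (e : FoliatedChart X n) (x : X) : EuclideanSpace ℝ (Fin n) := (e.toHomeo x).1

/-- The distinguished projection onto the transverse space. -/
def proj (e : FoliatedChart X n) (x : X) : e.T := (e.toHomeo x).2

/-- The inverse of the chart. -/
def inv (e : FoliatedChart X n) (v : EuclideanSpace ℝ (Fin n)) (w : e.T) : X :=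
  e.toHomeo.symm (v, w)

/-- The plaques of the chart are the fibres of the distinguished projection. -/
def plaque (e : FoliatedChart X n) (w : e.T) : Set X := {x | x ∈ e.source ∧ e.proj x = w}

end FoliatedChart

/-- A `C^∞` foliated structure of dimension `n` on `X`, given by a `C^∞` foliated atlas. -/
structure SmoothFoliation (X : Type u) [TopologicalSpace X] (n : ℕ) where
  charts : Set (FoliatedChart X n)
  cover : ∀ x : X, ∃ e ∈ charts, x ∈ e.source
  /-- intersections of plaques are open in the plaques -/
  plaque_inter : ∀ e ∈ charts, ∀ e' ∈ charts, ∀ (w : e.T) (w' : e'.T),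
    IsOpen ((↑) ⁻¹' e'.plaque w' : Set (e.plaque w))
  /-- the leafwise component of every change of coordinates is leafwise `C^∞` -/
  smooth_change : ∀ e ∈ charts, ∀ e' ∈ charts,
    LeafwiseSmoothOn univ
      (fun p : EuclideanSpace ℝ (Fin n) × e.T => e'.coord (e.inv p.1 p.2))
      {p | p.1 ∈ e.B ∧ e.inv p.1 p.2 ∈ e'.source}

namespace SmoothFoliation

variable {X : Type u} [TopologicalSpace X] {n : ℕ}

/-- The leaf topology: the topology on `X` generated by the open subsets of the plaques. -/
abbrev leafTopology (F : SmoothFoliation X n) : TopologicalSpace X :=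
  TopologicalSpace.generateFrom
    {s | ∃ e ∈ F.charts, ∃ (w : e.T) (O : Set X), IsOpen O ∧ s = O ∩ e.plaque w}

/-- The leaves are the connected components of `X` for the leaf topology. -/
def IsLeaf (F : SmoothFoliation X n) (L : Set X) : Prop :=
  ∃ x : X, L = @connectedComponent X F.leafTopology x

/-- `D` has compact closure in its leaf. (Leaves are closed for the leaf topology.) -/
def IsRelativelyCompactInLeaf (F : SmoothFoliation X n) (D : Set X) : Prop :=
  @IsCompact X F.leafTopology (@closure X F.leafTopology D)

/-- A regular domain of a leaf: a connected subset, of codimension zero and with `C^∞` boundary.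
Near every point of its boundary in the leaf, `D` is given in leafwise coordinates by `ρ < 0`,
where `ρ` is a `C^∞` function with non-vanishing differential and `ρ = 0` on the boundary.
Boundary points may or may not belong to `D`, so that both the open domains with `C^∞` boundary
and their closures are included. -/
structure IsRegularDomain (F : SmoothFoliation X n) (D : Set X) : Prop where
  connected : @IsConnected X F.leafTopology D
  boundary : ∀ e ∈ F.charts, ∀ x ∈ e.source, x ∈ @frontier X F.leafTopology D →
    ∃ W ∈ 𝓝 (e.coord x), W ⊆ e.B ∧ ∃ ρ : EuclideanSpace ℝ (Fin n) → ℝ,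
      ContDiffOn ℝ ∞ ρ W ∧ ρ (e.coord x) = 0 ∧ fderiv ℝ ρ (e.coord x) ≠ 0 ∧
      ∀ a ∈ W, (ρ a < 0 → e.inv a (e.proj x) ∈ D) ∧ (0 < ρ a → e.inv a (e.proj x) ∉ D)

/-- `F.HasHolonomy c e₀ t e h` says that the restriction of the leafwise path `c` to `[0, t]` is
covered by a finite sequence of charts of the atlas starting with `e₀` and ending with `e`, and that
the germ of `h` at the transverse coordinate of `c 0` is the corresponding composite of elementary
holonomy transformations. When the path passes from a chart `e` to a chart `e'` at the time `s`, the
elementary holonomy transformation is the germ of a map `g` with `g ∘ e.proj = e'.proj` near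
`c s`. -/
inductive HasHolonomy (F : SmoothFoliation X n) (c : I → X) (e₀ : FoliatedChart X n) :
    (t : I) → (e : FoliatedChart X n) → (e₀.T → e.T) → Prop
  | start (t : I) (he₀ : e₀ ∈ F.charts) (hc : ∀ r ∈ Icc 0 t, c r ∈ e₀.source) :
      HasHolonomy F c e₀ t e₀ id
  | step (s t : I) (e e' : FoliatedChart X n) (h : e₀.T → e.T) (g : e.T → e'.T)
      (prev : HasHolonomy F c e₀ s e h) (he' : e' ∈ F.charts) (hst : s ≤ t)
      (hc : ∀ r ∈ Icc s t, c r ∈ e'.source)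
      (hg : ∀ᶠ y in 𝓝 (c s), g (e.proj y) = e'.proj y) :
      HasHolonomy F c e₀ t e' (g ∘ h)

/-- A subset `D` of a leaf is without holonomy when every loop in `D`, continuous for the leaf
topology, has trivial holonomy germ. -/
def WithoutHolonomy (F : SmoothFoliation X n) (D : Set X) : Prop :=
  ∀ c : I → X, Continuous[inferInstance, F.leafTopology] c → c 0 = c 1 → (∀ t, c t ∈ D) →
    ∀ (e : FoliatedChart X n) (h : e.T → e.T), F.HasHolonomy c e 1 e h →
      ∀ᶠ w in 𝓝 (e.proj (c 0)), h w = w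

/-- A `C^∞` path `[0, 1] → L` in a leaf `L`: continuous for the leaf topology, and `C^∞` in the
leafwise coordinates (with one-sided derivatives at the endpoints). -/
def IsSmoothLeafPath (F : SmoothFoliation X n) (c : I → X) : Prop :=
  Continuous[inferInstance, F.leafTopology] c ∧
    ∀ e ∈ F.charts, ∀ t : I, c t ∈ e.source →
      ContDiffWithinAt ℝ ∞ (fun r : ℝ => e.coord (c (projIcc 0 1 zero_le_one r))) (Icc 0 1) t

/-- A `C^∞` foliated map: continuous, mapping leaves into leaves, with leafwise `C^∞` local
representations. -/
structure IsSmoothFoliatedMap {X' : Type v} [TopologicalSpace X'] {n' : ℕ}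
    (F : SmoothFoliation X n) (F' : SmoothFoliation X' n') (f : X → X') : Prop where
  continuous : Continuous f
  foliated : ∀ L, F.IsLeaf L → ∃ L', F'.IsLeaf L' ∧ f '' L ⊆ L'
  smooth : ∀ e ∈ F.charts, ∀ e' ∈ F'.charts,
    LeafwiseSmoothOn univ
      (fun p : EuclideanSpace ℝ (Fin n) × e.T => e'.coord (f (e.inv p.1 p.2)))
      {p | p.1 ∈ e.B ∧ f (e.inv p.1 p.2) ∈ e'.source}

/-- A `C^∞` foliated diffeomorphism: a bijection that is a `C^∞` foliated map together with its
inverse. -/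
def IsSmoothFoliatedDiffeo (F : SmoothFoliation X n) (f : X → X) : Prop :=
  F.IsSmoothFoliatedMap F f ∧ ∃ g : X → X, Function.LeftInverse g f ∧
    Function.RightInverse g f ∧ F.IsSmoothFoliatedMap F g

/-- A `C^∞` leafwise homotopy: a `C^∞` foliated map `X × [0, 1] → X`, where `X × [0, 1]` is the
foliated space (with boundary) whose leaves are the products `L × [0, 1]`. -/
structure IsSmoothLeafwiseHomotopy (F : SmoothFoliation X n) (φ : X × I → X) : Prop where
  continuous : Continuous φ
  leafwise : ∀ L, F.IsLeaf L → ∃ L', F.IsLeaf L' ∧ φ '' (L ×ˢ univ) ⊆ L'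
  smooth : ∀ e ∈ F.charts, ∀ e' ∈ F.charts,
    LeafwiseSmoothOn (univ ×ˢ Icc 0 1)
      (fun p : (EuclideanSpace ℝ (Fin n) × ℝ) × e.T =>
        e'.coord (φ (e.inv p.1.1 p.2, projIcc 0 1 zero_le_one p.1.2)))
      {p | p.1.1 ∈ e.B ∧ p.1.2 ∈ Icc 0 1 ∧
        φ (e.inv p.1.1 p.2, projIcc 0 1 zero_le_one p.1.2) ∈ e'.source}

/-- A `C^∞` leafwise diffeotopy: a `C^∞` leafwise homotopy that starts at the identity and consists
of `C^∞` foliated diffeomorphisms. -/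
structure IsSmoothLeafwiseDiffeotopy (F : SmoothFoliation X n) (φ : X × I → X) : Prop where
  homotopy : F.IsSmoothLeafwiseHomotopy φ
  diffeo : ∀ t : I, F.IsSmoothFoliatedDiffeo (fun x => φ (x, t))
  zero : ∀ x : X, φ (x, 0) = x

/-- The support of a diffeotopy: the closure of the set of points that are moved at some time. -/
def diffeotopySupport (φ : X × I → X) : Set X := closure {x | ∃ t : I, φ (x, t) ≠ x}

end SmoothFoliation

end

noncomputable section

/-! A short piece of the path lies in one plaque of one chart, where a translation in the leafwise
coordinates, cut off along the leaf and across it, carries one point of the piece to another. With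
`l` a bump function on ℝⁿ and `μ` a cutoff on the transversal, the map is `y ↦ y + l y • (μ w • v
t)`, where `v t` is the difference of the coordinates of the two points. For small `v` it is a
diffeomorphism of every plaque, it is the identity outside a closed box inside `U`, and its inverse
is jointly smooth in `y` and the displacement (`exists_isSupportedFamily_push`,
`isSmoothLeafwiseMotion_chartPush`).

The pushes are composed at each fixed time, not concatenated in time. The smooth clock `clampAt h b`
follows `t` up to `b - h` and stops at `b`. If a motion already carries `c 0` along `c ∘ clampAt h
(j * h)`, the next push must carry `c (clampAt h (j * h) t)` to `c (clampAt h (j * h + h) t)`.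
Before time `j * h - h` these points coincide and the push is the identity; afterwards both lie on a
piece of length `2 * h`, which fits into one chart by a Lebesgue number argument
(`exists_isInvertibleMotion_near`, `exists_isInvertibleMotion_clampAt`). Each push is prescribed at
a single point at each time, so a path that crosses or retraces itself causes no conflict. -/

/-- Pointwise version of `LeafwiseSmoothOn S g V` for `V` relatively open in `S × Y`. -/
def LeafwiseSmoothAt {A G Y : Type*} [NormedAddCommGroup A] [NormedSpace ℝ A]
    [NormedAddCommGroup G] [NormedSpace ℝ G] [TopologicalSpace Y]
    (S : Set A) (g : A × Y → G) (p : A × Y) : Prop :=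
  (∀ᶠ q in 𝓝[S ×ˢ univ] p, ContDiffWithinAt ℝ ∞ (fun a => g (a, q.2)) S q.1) ∧
    ∀ k : ℕ, ContinuousWithinAt
      (fun q : A × Y => iteratedFDerivWithin ℝ k (fun a => g (a, q.2)) S q.1) (S ×ˢ univ) p

/-! ### Calculus of functions smooth along leaves and continuous across them -/

namespace LeafwiseSmoothAt

theorem eventually_slice {A Y : Type*} [TopologicalSpace A] [TopologicalSpace Y]
    {S : Set A}
    {p : A × Y} {P : A × Y → Prop} (h : ∀ᶠ q in 𝓝[S ×ˢ univ] p, P q) :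
    ∀ᶠ a in 𝓝[S] p.1, P (a, p.2) := by
  have : Tendsto (fun a : A => (a, p.2)) (𝓝[S] p.1) (𝓝[S ×ˢ univ] p) := by
    refine tendsto_nhdsWithin_iff.2 ⟨?_, ?_⟩
    · exact ((continuous_id.prodMk continuous_const).tendsto p.1).mono_left nhdsWithin_le_nhds
    · filter_upwards [self_mem_nhdsWithin] with a ha using ⟨ha, mem_univ _⟩
  exact this.eventually h

theorem eventually_eventually_slice {A Y : Type*} [TopologicalSpace A] [TopologicalSpace Y]
    {S : Set A}
    {p : A × Y} {P : A × Y → Prop} (h : ∀ᶠ q in 𝓝[S ×ˢ univ] p, P q) :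
    ∀ᶠ q in 𝓝[S ×ˢ univ] p, ∀ᶠ a in 𝓝[S] q.1, P (a, q.2) :=
  (eventually_eventually_nhdsWithin.2 h).mono fun _ hq => eventually_slice hq

variable {A A' G G' Y Y' Z : Type*} [NormedAddCommGroup A] [NormedSpace ℝ A]
  [NormedAddCommGroup A'] [NormedSpace ℝ A'] [NormedAddCommGroup Z] [NormedSpace ℝ Z]
  [NormedAddCommGroup G] [NormedSpace ℝ G] [NormedAddCommGroup G'] [NormedSpace ℝ G']
  [TopologicalSpace Y] [TopologicalSpace Y']
  {S : Set A} {S' : Set A'} {p : A × Y}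

theorem of_on {g : A × Y → G} {V : Set (A × Y)} (h : LeafwiseSmoothOn S g V)
    (hV : V ∈ 𝓝[S ×ˢ univ] p) (hp : p.1 ∈ S) : LeafwiseSmoothAt S g p := by
  refine ⟨mem_of_superset hV h.1, fun k => ?_⟩
  have hpV : p ∈ V := mem_of_mem_nhdsWithin (mk_mem_prod hp (mem_univ _)) hV
  exact (h.2 k p hpV).mono_of_mem_nhdsWithin hV

theorem leafwiseSmoothOn {g : A × Y → G} {V : Set (A × Y)} (hV : ∀ p ∈ V, p.1 ∈ S)
    (h : ∀ p ∈ V, LeafwiseSmoothAt S g p) : LeafwiseSmoothOn S g V :=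
  ⟨fun p hp => (h p hp).1.self_of_nhdsWithin ⟨hV p hp, mem_univ _⟩,
    fun k p hp => ((h p hp).2 k).mono fun q hq => ⟨hV q hq, mem_univ _⟩⟩

theorem congr {g g' : A × Y → G} (h : LeafwiseSmoothAt S g p) (hp : p.1 ∈ S)
    (hg : ∀ᶠ q in 𝓝[S ×ˢ univ] p, g' q = g q) : LeafwiseSmoothAt S g' p := by
  have hs := eventually_eventually_slice hg
  have hmem : ∀ᶠ q in 𝓝[S ×ˢ univ] p, q ∈ S ×ˢ (univ : Set Y) := self_mem_nhdsWithin
  refine ⟨?_, fun k => ?_⟩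
  · filter_upwards [h.1, hs, hmem] with q h1 h2 h3
    exact h1.congr_of_eventuallyEq h2 (h2.self_of_nhdsWithin h3.1)
  · refine (h.2 k).congr_of_eventuallyEq ?_ ?_
    · filter_upwards [hs, hmem] with q h2 h3
      exact Filter.EventuallyEq.iteratedFDerivWithin_eq h2 (h2.self_of_nhdsWithin h3.1) k
    · have h2 := hs.self_of_nhdsWithin (⟨hp, mem_univ _⟩ : p ∈ S ×ˢ (univ : Set Y))
      exact Filter.EventuallyEq.iteratedFDerivWithin_eq h2 (h2.self_of_nhdsWithin hp) k

theorem continuousWithinAt {g : A × Y → G} (h : LeafwiseSmoothAt S g p) :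
    ContinuousWithinAt g (S ×ˢ univ) p := by
  have := (h.2 0)
  have h2 := ((continuousMultilinearCurryFin0 ℝ A G).continuous.continuousAt).comp_continuousWithinAt
    this
  refine h2.congr (fun q _ => ?_) ?_ <;> simp [iteratedFDerivWithin_zero_eq_comp]

/-- By the Faà di Bruno formula, each derivative of the composite is a continuous expression in the
derivatives of `g` and `f`. Since `θ` depends on the transverse variable alone, no transverse
derivative of `g` occurs. -/
theorem comp {g : A' × Y' → G} {f : A × Y → A'} {θ : Y → Y'}
    (hS : UniqueDiffOn ℝ S) (hS' : UniqueDiffOn ℝ S') (hp : p.1 ∈ S)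
    (hg : LeafwiseSmoothAt S' g (f p, θ p.2)) (hf : LeafwiseSmoothAt S f p)
    (hθ : ContinuousAt θ p.2) (hfS : ∀ᶠ q in 𝓝[S ×ˢ univ] p, f q ∈ S') :
    LeafwiseSmoothAt S (fun q => g (f q, θ q.2)) p := by
  have ht : Tendsto (fun q : A × Y => (f q, θ q.2)) (𝓝[S ×ˢ univ] p)
      (𝓝[S' ×ˢ univ] (f p, θ p.2)) := by
    refine tendsto_nhdsWithin_iff.2 ⟨?_, hfS.mono fun q hq => ⟨hq, mem_univ _⟩⟩
    exact hf.continuousWithinAt.prodMk_nhds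
      ((hθ.tendsto.comp (continuous_snd.tendsto p)).mono_left nhdsWithin_le_nhds)
  have hmem : ∀ᶠ q in 𝓝[S ×ˢ univ] p, q ∈ S ×ˢ (univ : Set Y) := self_mem_nhdsWithin
  have hmem' := eventually_eventually_slice hfS
  have hgc := ht.eventually hg.1
  refine ⟨?_, fun k => ?_⟩
  · filter_upwards [hgc, hf.1, hmem', hmem] with q h1 h2 h3 h4
    exact ContDiffWithinAt.comp_of_preimage_mem_nhdsWithin (f := fun a => f (a, q.2))
      (g := fun a' => g (a', θ q.2)) q.1 h1 h2 h3
  · have key : ∀ᶠ q in 𝓝[S ×ˢ univ] p,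
        iteratedFDerivWithin ℝ k (fun a => g (f (a, q.2), θ q.2)) S q.1 =
        (ftaylorSeriesWithin ℝ (fun a' => g (a', θ q.2)) S' (f q)).taylorComp
          (ftaylorSeriesWithin ℝ (fun a => f (a, q.2)) S q.1) k := by
      filter_upwards [hgc, hf.1, hmem', hmem] with q h1 h2 h3 h4
      exact iteratedFDerivWithin_comp_of_eventually_mem (f := fun a => f (a, q.2))
        (g := fun a' => g (a', θ q.2)) h1 h2 hS' hS h4.1 h3
        (by exact_mod_cast le_top)
    refine ContinuousWithinAt.congr_of_eventuallyEq ?_ key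
      (key.self_of_nhdsWithin ⟨hp, mem_univ _⟩)
    simp only [FormalMultilinearSeries.taylorComp,
      FormalMultilinearSeries.compAlongOrderedFinpartition]
    refine tendsto_finsetSum _ fun c _ => ?_
    have h1 : ContinuousWithinAt (fun q : A × Y =>
        c.compAlongOrderedFinpartitionL ℝ A A' G
          (ftaylorSeriesWithin ℝ (fun a' => g (a', θ q.2)) S' (f q) c.length)) (S ×ˢ univ) p :=
      (c.compAlongOrderedFinpartitionL ℝ A A' G).continuous.continuousAt.comp_continuousWithinAt
        ((hg.2 c.length).tendsto.comp ht)
    have h2 : ContinuousWithinAt (fun q : A × Y => fun m : Fin c.length =>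
        ftaylorSeriesWithin ℝ (fun a => f (a, q.2)) S q.1 (c.partSize m)) (S ×ˢ univ) p :=
      continuousWithinAt_pi.2 fun m => hf.2 (c.partSize m)
    exact h1.eval h2

theorem prodMk {f : A × Y → G} {g : A × Y → G'} (hS : UniqueDiffOn ℝ S) (hp : p.1 ∈ S)
    (hf : LeafwiseSmoothAt S f p) (hg : LeafwiseSmoothAt S g p) :
    LeafwiseSmoothAt S (fun q => (f q, g q)) p := by
  have hmem : ∀ᶠ q in 𝓝[S ×ˢ univ] p, q ∈ S ×ˢ (univ : Set Y) := self_mem_nhdsWithin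
  refine ⟨?_, fun k => ?_⟩
  · filter_upwards [hf.1, hg.1] with q h1 h2 using h1.prodMk h2
  · have key : ∀ᶠ q in 𝓝[S ×ˢ univ] p,
        iteratedFDerivWithin ℝ k (fun a => (f (a, q.2), g (a, q.2))) S q.1 =
        (iteratedFDerivWithin ℝ k (fun a => f (a, q.2)) S q.1).prod
          (iteratedFDerivWithin ℝ k (fun a => g (a, q.2)) S q.1) := by
      filter_upwards [hf.1, hg.1, hmem] with q h1 h2 h3
      exact iteratedFDerivWithin_prodMk h1 h2 hS h3.1 (by exact_mod_cast le_top)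
    refine ContinuousWithinAt.congr_of_eventuallyEq ?_ key
      (key.self_of_nhdsWithin ⟨hp, mem_univ _⟩)
    exact (ContinuousMultilinearMap.prodL ℝ (fun _ : Fin k => A) G
      G').continuous.continuousAt.comp_continuousWithinAt
      ((hf.2 k).prodMk (hg.2 k))

theorem of_contDiffOn {g : A → G} (hS : UniqueDiffOn ℝ S) (hp : p.1 ∈ S)
    (hg : ContDiffOn ℝ ∞ g S) : LeafwiseSmoothAt S (fun q : A × Y => g q.1) p := by
  have hmem : ∀ᶠ q in 𝓝[S ×ˢ univ] p, q ∈ S ×ˢ (univ : Set Y) := self_mem_nhdsWithin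
  refine ⟨hmem.mono fun q hq => hg q.1 hq.1, fun k => ?_⟩
  have := (hg.continuousOn_iteratedFDerivWithin (m := k) (by exact_mod_cast le_top) hS) p.1 hp
  exact this.comp continuous_fst.continuousWithinAt fun q hq => hq.1

theorem of_continuousAt {s : Y → G} (hs : ContinuousAt s p.2) :
    LeafwiseSmoothAt S (fun q : A × Y => s q.2) p := by
  refine ⟨Eventually.of_forall fun q => contDiffWithinAt_const (c := s q.2), fun k => ?_⟩
  rcases k with _ | k
  · simp only [iteratedFDerivWithin_zero_eq_comp]
    exact (continuousMultilinearCurryFin0 ℝ A G).symm.continuous.continuousAt.comp_continuousWithinAt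
      (hs.comp_of_eq continuousAt_snd rfl).continuousWithinAt
  · simp only [iteratedFDerivWithin_const_of_ne (Nat.succ_ne_zero k)]
    exact continuousWithinAt_const

/-- The value `s y` is constant on each slice, so it can be fed into an extra smooth variable of
`g`. This lets a merely continuous transverse cutoff enter a leafwise smooth map. -/
theorem of_parameter {g : A × Z → G} {s : Y → Z} {K : Set Z} (hS : UniqueDiffOn ℝ S)
    (hK : UniqueDiffOn ℝ K) (hp : p.1 ∈ S) (hg : ContDiffOn ℝ ∞ g (S ×ˢ K))
    (hs : ContinuousAt s p.2) (hsK : ∀ y, s y ∈ K) :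
    LeafwiseSmoothAt S (fun q : A × Y => g (q.1, s q.2)) p := by
  have h1 : LeafwiseSmoothAt (S ×ˢ K) (fun q : (A × Z) × Y => g q.1) ((p.1, s p.2), p.2) :=
    of_contDiffOn (hS.prod hK) ⟨hp, hsK _⟩ hg
  have h2 : LeafwiseSmoothAt S (fun q : A × Y => (q.1, s q.2)) p :=
    prodMk hS hp (of_contDiffOn hS hp contDiffOn_id) (of_continuousAt hs)
  refine comp (θ := id) hS (hS.prod hK) hp h1 h2 continuousAt_id ?_
  filter_upwards [self_mem_nhdsWithin] with q hq using ⟨hq.1, hsK _⟩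

end LeafwiseSmoothAt

/-! ### Coordinates of a foliated chart -/

namespace FoliatedChart

variable {X : Type u} [TopologicalSpace X] {n : ℕ} (e : FoliatedChart X n)

theorem isOpen_source : IsOpen e.source := e.toHomeo.open_source

theorem mem_target {v : EuclideanSpace ℝ (Fin n)} (hv : v ∈ e.B) (w : e.T) :
    (v, w) ∈ e.toHomeo.target := by
  rw [e.target_eq]; exact ⟨hv, mem_univ _⟩

theorem coord_mem {x : X} (hx : x ∈ e.source) : e.coord x ∈ e.B := by
  have := e.toHomeo.map_source hx
  rw [e.target_eq] at this
  exact this.1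

theorem inv_coord_proj {x : X} (hx : x ∈ e.source) : e.inv (e.coord x) (e.proj x) = x :=
  e.toHomeo.left_inv hx

variable {e}

theorem inv_mem {v : EuclideanSpace ℝ (Fin n)} (hv : v ∈ e.B) (w : e.T) : e.inv v w ∈ e.source :=
  e.toHomeo.map_target (e.mem_target hv w)

theorem coord_inv {v : EuclideanSpace ℝ (Fin n)} (hv : v ∈ e.B) (w : e.T) :
    e.coord (e.inv v w) = v :=
  congrArg Prod.fst (e.toHomeo.right_inv (e.mem_target hv w))

theorem proj_inv {v : EuclideanSpace ℝ (Fin n)} (hv : v ∈ e.B) (w : e.T) :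
    e.proj (e.inv v w) = w :=
  congrArg Prod.snd (e.toHomeo.right_inv (e.mem_target hv w))

theorem continuousAt_coord {x : X} (hx : x ∈ e.source) : ContinuousAt e.coord x :=
  continuousAt_fst.comp (e.toHomeo.continuousAt hx)

theorem continuousAt_proj {x : X} (hx : x ∈ e.source) : ContinuousAt e.proj x :=
  continuousAt_snd.comp (e.toHomeo.continuousAt hx)

theorem continuousAt_inv {v : EuclideanSpace ℝ (Fin n)} (hv : v ∈ e.B) (w : e.T) :
    ContinuousAt (fun p : EuclideanSpace ℝ (Fin n) × e.T => e.inv p.1 p.2) (v, w) :=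
  e.toHomeo.continuousAt_symm (e.mem_target hv w)

theorem continuousAt_inv_param {q : X × I} (hq : q.1 ∈ e.source) :
    Tendsto (fun p : (EuclideanSpace ℝ (Fin n) × ℝ) × e.T =>
      ((e.inv p.1.1 p.2, projIcc 0 1 zero_le_one p.1.2) : X × I))
      (𝓝 ((e.coord q.1, (q.2 : ℝ)), e.proj q.1)) (𝓝 q) := by
  have h1 := (continuousAt_inv (e.coord_mem hq) (e.proj q.1)).tendsto
  have h2 : Tendsto (fun p : (EuclideanSpace ℝ (Fin n) × ℝ) × e.T => (p.1.1, p.2))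
      (𝓝 ((e.coord q.1, (q.2 : ℝ)), e.proj q.1)) (𝓝 (e.coord q.1, e.proj q.1)) :=
    (by fun_prop : Continuous fun p : (EuclideanSpace ℝ (Fin n) × ℝ) × e.T =>
      (p.1.1, p.2)).tendsto _
  have h3 : Tendsto (fun p : (EuclideanSpace ℝ (Fin n) × ℝ) × e.T =>
      projIcc (0 : ℝ) 1 zero_le_one p.1.2)
      (𝓝 ((e.coord q.1, (q.2 : ℝ)), e.proj q.1)) (𝓝 (projIcc 0 1 zero_le_one (q.2 : ℝ))) :=
    (continuous_projIcc.comp (continuous_snd.comp continuous_fst)).tendsto _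
  have := (h1.comp h2).prodMk_nhds h3
  simpa only [Function.comp_def, e.inv_coord_proj hq, projIcc_val, Prod.mk.eta] using this

end FoliatedChart

/-! ### Leafwise smooth motions, independence of charts, composition -/

namespace SmoothFoliation

variable {X : Type u} [TopologicalSpace X] {n : ℕ} {F : SmoothFoliation X n}

/-- The local representation of a homotopy in a pair of foliated charts. -/
def localRep (φ : X × I → X) (e e' : FoliatedChart X n) :
    (EuclideanSpace ℝ (Fin n) × ℝ) × e.T → EuclideanSpace ℝ (Fin n) :=
  fun p => e'.coord (φ (e.inv p.1.1 p.2, projIcc 0 1 zero_le_one p.1.2))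

theorem uniqueDiffOn_univ_prod_Icc :
    UniqueDiffOn ℝ ((univ : Set (EuclideanSpace ℝ (Fin n))) ×ˢ Icc (0 : ℝ) 1) :=
  uniqueDiffOn_univ.prod (uniqueDiffOn_Icc zero_lt_one)

/-- Near `q`, the homotopy `φ` maps plaques of `e` into plaques of `e'`, and it is leafwise smooth
in these charts. -/
structure ChartSmoothAt (φ : X × I → X) (e e' : FoliatedChart X n) (q : X × I) : Prop where
  mem : q.1 ∈ e.source
  mem' : φ q ∈ e'.source
  transverse : ∃ θ : e.T → e'.T, ∀ᶠ q' in 𝓝 q, e'.proj (φ q') = θ (e.proj q'.1)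
  smooth : LeafwiseSmoothAt (univ ×ˢ Icc 0 1) (localRep φ e e')
    ((e.coord q.1, q.2), e.proj q.1)

namespace ChartSmoothAt

theorem congr {φ φ' : X × I → X} {e e' : FoliatedChart X n} {q : X × I}
    (h : ChartSmoothAt φ e e' q) (hφ : ∀ᶠ q' in 𝓝 q, φ' q' = φ q') :
    ChartSmoothAt φ' e e' q where
  mem := h.mem
  mem' := by rw [hφ.self_of_nhds]; exact h.mem'
  transverse := by
    obtain ⟨θ, hθ⟩ := h.transverse
    refine ⟨θ, ?_⟩
    filter_upwards [hθ, hφ] with q' h1 h2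
    rw [h2, h1]
  smooth := by
    refine h.smooth.congr ⟨mem_univ _, q.2.2⟩ (mem_nhdsWithin_of_mem_nhds ?_)
    filter_upwards [(FoliatedChart.continuousAt_inv_param h.mem).eventually hφ] with p hp
    simp only [localRep]
    rw [hp]

/-- Locally each motion has the form `((a, t), w) ↦ (f ((a, t), w), θ w)`, and this form is stable
under composition at equal times. The leafwise part is handled by `LeafwiseSmoothAt.comp`, with the
time kept as an additional component. -/
theorem comp {φ₁ φ₂ : X × I → X} {e e₁ e' : FoliatedChart X n} {q : X × I}
    (h₂ : ChartSmoothAt φ₂ e₁ e' (φ₁ q, q.2)) (h₁ : ChartSmoothAt φ₁ e e₁ q)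
    (hc₁ : Continuous φ₁) : ChartSmoothAt (fun q => φ₂ (φ₁ q, q.2)) e e' q := by
  obtain ⟨θ₁, hθ₁⟩ := h₁.transverse
  obtain ⟨θ₂, hθ₂⟩ := h₂.transverse
  have ht : Tendsto (fun q => (φ₁ q, q.2)) (𝓝 q) (𝓝 (φ₁ q, q.2)) :=
    (hc₁.prodMk continuous_snd).tendsto q
  have hsrc : ∀ᶠ q' in 𝓝 q, φ₁ q' ∈ e₁.source :=
    hc₁.continuousAt.eventually_mem (e₁.isOpen_source.mem_nhds h₁.mem')
  have hpar := FoliatedChart.continuousAt_inv_param h₁.mem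
  have hB : ∀ᶠ p in 𝓝 (((e.coord q.1, (q.2 : ℝ)), e.proj q.1) :
      (EuclideanSpace ℝ (Fin n) × ℝ) × e.T), p.1.1 ∈ e.B :=
    (continuous_fst.comp continuous_fst).continuousAt.eventually_mem
      (e.isOpen_B.mem_nhds (e.coord_mem h₁.mem))
  have hinv : Tendsto (fun w => ((e.inv (e.coord q.1) w, q.2) : X × I)) (𝓝 (e.proj q.1))
      (𝓝 q) := by
    have h0 : Tendsto (fun w : e.T => ((e.coord q.1, (q.2 : ℝ)), w)) (𝓝 (e.proj q.1))
        (𝓝 ((e.coord q.1, (q.2 : ℝ)), e.proj q.1)) :=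
      (continuous_const.prodMk continuous_id).tendsto _
    simpa [Function.comp_def] using hpar.comp h0
  -- Continuity of `θ₁` is not part of the data; it is recovered by evaluating `φ₁` on the
  -- transversal through `q`.
  have hθeq : ∀ᶠ w in 𝓝 (e.proj q.1),
      θ₁ w = e₁.proj (φ₁ (e.inv (e.coord q.1) w, q.2)) := by
    filter_upwards [hinv.eventually hθ₁] with w hw
    rw [hw]
    simp only [FoliatedChart.proj_inv (e.coord_mem h₁.mem)]
  have hθc : ContinuousAt θ₁ (e.proj q.1) := by
    refine ContinuousAt.congr ?_ (hθeq.mono fun w hw => hw.symm)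
    have h3 : Tendsto (fun w => e₁.proj (φ₁ (e.inv (e.coord q.1) w, q.2))) (𝓝 (e.proj q.1))
        (𝓝 (e₁.proj (φ₁ q))) :=
      ((FoliatedChart.continuousAt_proj h₁.mem').comp hc₁.continuousAt).tendsto.comp hinv
    rw [ContinuousAt]
    simpa only [e.inv_coord_proj h₁.mem] using h3
  have hθq : θ₁ (e.proj q.1) = e₁.proj (φ₁ q) := hθ₁.self_of_nhds.symm
  refine ⟨h₁.mem, h₂.mem', ⟨θ₂ ∘ θ₁, ?_⟩, ?_⟩
  · filter_upwards [hθ₁, ht.eventually hθ₂] with q' h1 h2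
    rw [h2]
    simp only [Function.comp]
    rw [h1]
  · have hq : (((e.coord q.1, (q.2 : ℝ)), e.proj q.1) :
        (EuclideanSpace ℝ (Fin n) × ℝ) × e.T).1 ∈
        (univ : Set (EuclideanSpace ℝ (Fin n))) ×ˢ Icc (0 : ℝ) 1 := ⟨mem_univ _, q.2.2⟩
    have hs := uniqueDiffOn_univ_prod_Icc (n := n)
    have hf : LeafwiseSmoothAt (univ ×ˢ Icc 0 1)
        (fun p : (EuclideanSpace ℝ (Fin n) × ℝ) × e.T => (localRep φ₁ e e₁ p, p.1.2))
        ((e.coord q.1, (q.2 : ℝ)), e.proj q.1) :=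
      h₁.smooth.prodMk hs hq (LeafwiseSmoothAt.of_contDiffOn hs hq contDiff_snd.contDiffOn)
    have hrep : localRep φ₁ e e₁ ((e.coord q.1, (q.2 : ℝ)), e.proj q.1) = e₁.coord (φ₁ q) := by
      simp only [localRep, e.inv_coord_proj h₁.mem, projIcc_val]
    have hcomp := LeafwiseSmoothAt.comp (g := localRep φ₂ e₁ e') (θ := θ₁) hs hs hq
      (by simpa only [hrep, hθq] using h₂.smooth) hf hθc
      (by filter_upwards [self_mem_nhdsWithin] with p hp using ⟨mem_univ _, hp.1.2⟩)
    refine hcomp.congr hq (mem_nhdsWithin_of_mem_nhds ?_)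
    filter_upwards [hpar.eventually hsrc, hpar.eventually hθ₁, hB] with p h1 h2 h3
    simp only [localRep]
    congr 3
    rw [FoliatedChart.proj_inv h3] at h2
    rw [← h2, e₁.inv_coord_proj h1]

end ChartSmoothAt

/-- Openness of plaque intersections makes the transverse coordinate of `e'` locally constant along
plaques of `e`. It is therefore constant on a leafwise ball, which is connected, and can be
evaluated at the centre. -/
theorem eventually_proj_eq (F : SmoothFoliation X n) {e e' : FoliatedChart X n}
    (he : e ∈ F.charts) (he' : e' ∈ F.charts) {x : X} (hx : x ∈ e.source) (hx' : x ∈ e'.source) :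
    ∀ᶠ y in 𝓝 x, e'.proj y = e'.proj (e.inv (e.coord x) (e.proj y)) := by
  have hev : ∀ᶠ p in 𝓝 (e.coord x, e.proj x), p.1 ∈ e.B ∧ e.inv p.1 p.2 ∈ e'.source := by
    refine (continuousAt_fst.eventually_mem
      (e.isOpen_B.mem_nhds (e.coord_mem hx))).and ?_
    refine (FoliatedChart.continuousAt_inv (e.coord_mem hx) (e.proj x)).eventually_mem ?_
    simp only [e.inv_coord_proj hx]
    exact e'.isOpen_source.mem_nhds hx'
  rw [nhds_prod_eq, Filter.eventually_prod_iff] at hev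
  obtain ⟨P, hP, Q, hQ, hPQ⟩ := hev
  obtain ⟨δ, hδ, hball⟩ := Metric.eventually_nhds_iff_ball.1 hP
  have h1 : ∀ᶠ y in 𝓝 x, e.coord y ∈ Metric.ball (e.coord x) δ :=
    (FoliatedChart.continuousAt_coord hx).eventually_mem (Metric.ball_mem_nhds _ hδ)
  have h2 : ∀ᶠ y in 𝓝 x, Q (e.proj y) := (FoliatedChart.continuousAt_proj hx).eventually hQ
  filter_upwards [h1, h2, e.isOpen_source.mem_nhds hx] with y hy1 hy2 hy3
  set w := e.proj y with hw
  have hB : ∀ a ∈ Metric.ball (e.coord x) δ, a ∈ e.B := fun a ha => (hPQ (hball a ha) hy2).1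
  have hS : ∀ a ∈ Metric.ball (e.coord x) δ, e.inv a w ∈ e'.source :=
    fun a ha => (hPQ (hball a ha) hy2).2
  let m : Metric.ball (e.coord x) δ → e.plaque w := fun a =>
    ⟨e.inv a w, FoliatedChart.inv_mem (hB a a.2) w, FoliatedChart.proj_inv (hB a a.2) w⟩
  have hm : Continuous m := by
    refine Continuous.subtype_mk (continuous_iff_continuousAt.2 fun a => ?_) _
    exact ContinuousAt.comp (f := fun a : Metric.ball (e.coord x) δ =>
      ((a : EuclideanSpace ℝ (Fin n)), w)) (FoliatedChart.continuousAt_inv (hB a a.2) w)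
      (by fun_prop)
  have hloc : IsLocallyConstant (fun a : Metric.ball (e.coord x) δ => e'.proj (e.inv a w)) := by
    refine (IsLocallyConstant.iff_exists_open _).2 fun a => ?_
    refine ⟨m ⁻¹' ((↑) ⁻¹' e'.plaque (e'.proj (e.inv a w))),
      (F.plaque_inter e he e' he' w _).preimage hm, ⟨hS a a.2, rfl⟩, fun b hb => hb.2⟩
  have : PreconnectedSpace (Metric.ball (e.coord x) δ) :=
    Subtype.preconnectedSpace (convex_ball _ _).isPreconnected
  have := hloc.apply_eq_of_preconnectedSpace ⟨e.coord y, hy1⟩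
    ⟨e.coord x, Metric.mem_ball_self hδ⟩
  simpa only [hw, e.inv_coord_proj hy3] using this

/-- The change of coordinates seen as the stationary motion. Composing with it on both sides
replaces one pair of charts by any other, which is why smoothness of a motion needs checking in one
pair only. -/
theorem chartSmoothAt_fst (F : SmoothFoliation X n) {e e' : FoliatedChart X n}
    (he : e ∈ F.charts) (he' : e' ∈ F.charts) {q : X × I} (hx : q.1 ∈ e.source)
    (hx' : q.1 ∈ e'.source) : ChartSmoothAt Prod.fst e e' q := by
  refine ⟨hx, hx', ⟨fun w => e'.proj (e.inv (e.coord q.1) w),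
    continuousAt_fst.eventually (F.eventually_proj_eq he he' hx hx')⟩, ?_⟩
  have hq : (((e.coord q.1, (q.2 : ℝ)), e.proj q.1) :
      (EuclideanSpace ℝ (Fin n) × ℝ) × e.T).1 ∈
      (univ : Set (EuclideanSpace ℝ (Fin n))) ×ˢ Icc (0 : ℝ) 1 := ⟨mem_univ _, q.2.2⟩
  have hs := uniqueDiffOn_univ_prod_Icc (n := n)
  have hV : {p : EuclideanSpace ℝ (Fin n) × e.T | p.1 ∈ e.B ∧ e.inv p.1 p.2 ∈ e'.source} ∈
      𝓝 (e.coord q.1, e.proj q.1) := by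
    refine (continuousAt_fst.eventually_mem
      (e.isOpen_B.mem_nhds (e.coord_mem hx))).and ?_
    refine (FoliatedChart.continuousAt_inv (e.coord_mem hx) (e.proj q.1)).eventually_mem ?_
    simp only [e.inv_coord_proj hx]
    exact e'.isOpen_source.mem_nhds hx'
  have h1 := LeafwiseSmoothAt.of_on (F.smooth_change e he e' he')
    (mem_nhdsWithin_of_mem_nhds hV) (mem_univ _)
  exact LeafwiseSmoothAt.comp (g := fun p : EuclideanSpace ℝ (Fin n) × e.T =>
    e'.coord (e.inv p.1 p.2)) (f := fun p => p.1.1) (θ := id) hs uniqueDiffOn_univ hq h1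
    (LeafwiseSmoothAt.of_contDiffOn hs hq contDiff_fst.contDiffOn) continuousAt_id
    (Eventually.of_forall fun _ => mem_univ _)

/-- A continuous homotopy that moves every point inside its leaf and is leafwise smooth. -/
structure IsSmoothLeafwiseMotion (F : SmoothFoliation X n) (φ : X × I → X) : Prop where
  continuous : Continuous φ
  leaf : ∀ q, φ q ∈ @connectedComponent X F.leafTopology q.1
  smooth : ∀ q, ∃ e ∈ F.charts, ∃ e' ∈ F.charts, ChartSmoothAt φ e e' q

namespace IsSmoothLeafwiseMotion

variable {φ φ₁ φ₂ : X × I → X}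

theorem chartSmoothAt (h : F.IsSmoothLeafwiseMotion φ) {e e' : FoliatedChart X n}
    (he : e ∈ F.charts) (he' : e' ∈ F.charts) {q : X × I} (hq : q.1 ∈ e.source)
    (hq' : φ q ∈ e'.source) : ChartSmoothAt φ e e' q := by
  obtain ⟨e₁, he₁, e₂, he₂, h1⟩ := h.smooth q
  have h2 : ChartSmoothAt φ e e₂ q :=
    ChartSmoothAt.comp (φ₁ := Prod.fst) h1 (F.chartSmoothAt_fst he he₁ hq h1.mem) continuous_fst
  exact ChartSmoothAt.comp (φ₂ := Prod.fst) (q := q)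
    (F.chartSmoothAt_fst he₂ he' h1.mem' hq') h2 h.continuous

theorem fst (F : SmoothFoliation X n) : F.IsSmoothLeafwiseMotion Prod.fst where
  continuous := continuous_fst
  leaf q := @mem_connectedComponent X F.leafTopology q.1
  smooth q := by
    obtain ⟨e, he, hq⟩ := F.cover q.1
    exact ⟨e, he, e, he, F.chartSmoothAt_fst he he hq hq⟩

theorem comp (h₂ : F.IsSmoothLeafwiseMotion φ₂) (h₁ : F.IsSmoothLeafwiseMotion φ₁) :
    F.IsSmoothLeafwiseMotion (fun q => φ₂ (φ₁ q, q.2)) where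
  continuous := h₂.continuous.comp (h₁.continuous.prodMk continuous_snd)
  leaf q := by
    have h1 := @connectedComponent_eq X F.leafTopology _ _ (h₁.leaf q)
    rw [h1]
    exact h₂.leaf (φ₁ q, q.2)
  smooth q := by
    obtain ⟨e, he, hq⟩ := F.cover q.1
    obtain ⟨e₁, he₁, hq₁⟩ := F.cover (φ₁ q)
    obtain ⟨e₂, he₂, hq₂⟩ := F.cover (φ₂ (φ₁ q, q.2))
    exact ⟨e, he, e₂, he₂, (h₂.chartSmoothAt he₁ he₂ hq₁ hq₂).comp
      (h₁.chartSmoothAt he he₁ hq hq₁) h₁.continuous⟩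

theorem isSmoothLeafwiseHomotopy (h : F.IsSmoothLeafwiseMotion φ) :
    F.IsSmoothLeafwiseHomotopy φ where
  continuous := h.continuous
  leafwise := by
    rintro L ⟨x, rfl⟩
    refine ⟨_, ⟨x, rfl⟩, ?_⟩
    rintro _ ⟨q, ⟨hq, -⟩, rfl⟩
    rw [@connectedComponent_eq X F.leafTopology _ _ hq]
    exact h.leaf q
  smooth e he e' he' := by
    refine LeafwiseSmoothAt.leafwiseSmoothOn (fun p hp => ⟨mem_univ _, hp.2.1⟩) ?_
    rintro ⟨⟨y, t⟩, w⟩ ⟨hy, ht, hp⟩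
    have := (h.chartSmoothAt he he' (q := (e.inv y w, projIcc 0 1 zero_le_one t))
      (FoliatedChart.inv_mem hy w) hp).smooth
    simp only [FoliatedChart.coord_inv hy, FoliatedChart.proj_inv hy,
      projIcc_of_mem zero_le_one ht] at this
    exact this

theorem isSmoothFoliatedMap (h : F.IsSmoothLeafwiseMotion φ) (t : I) :
    F.IsSmoothFoliatedMap F (fun x => φ (x, t)) where
  continuous := h.continuous.comp (continuous_id.prodMk continuous_const)
  foliated := by
    intro L hL
    obtain ⟨L', hL', hsub⟩ := h.isSmoothLeafwiseHomotopy.leafwise L hL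
    refine ⟨L', hL', ?_⟩
    rintro _ ⟨x, hx, rfl⟩
    exact hsub ⟨(x, t), ⟨hx, mem_univ _⟩, rfl⟩
  smooth e he e' he' := by
    refine LeafwiseSmoothAt.leafwiseSmoothOn (fun p hp => mem_univ _) ?_
    rintro ⟨y, w⟩ ⟨hy, hp⟩
    have h1 := (h.chartSmoothAt he he' (q := (e.inv y w, t))
      (FoliatedChart.inv_mem hy w) hp).smooth
    simp only [FoliatedChart.coord_inv hy, FoliatedChart.proj_inv hy] at h1
    have h2 : LeafwiseSmoothAt univ (fun p : EuclideanSpace ℝ (Fin n) × e.T => (p.1, (t : ℝ)))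
        (y, w) :=
      LeafwiseSmoothAt.of_contDiffOn uniqueDiffOn_univ (mem_univ _)
        (contDiff_id.prodMk contDiff_const).contDiffOn
    have h3 := LeafwiseSmoothAt.comp (θ := id) uniqueDiffOn_univ
      (uniqueDiffOn_univ_prod_Icc (n := n))
      (mem_univ _) h1 h2 continuousAt_id
      (Eventually.of_forall fun _ => ⟨mem_univ _, t.2⟩)
    simpa only [localRep, projIcc_val, id] using h3

theorem isSmoothLeafwiseDiffeotopy {ψ : X × I → X} (hφ : F.IsSmoothLeafwiseMotion φ)
    (hψ : F.IsSmoothLeafwiseMotion ψ) (hψφ : ∀ x t, ψ (φ (x, t), t) = x)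
    (hφψ : ∀ x t, φ (ψ (x, t), t) = x) (h0 : ∀ x, φ (x, 0) = x) :
    F.IsSmoothLeafwiseDiffeotopy φ where
  homotopy := hφ.isSmoothLeafwiseHomotopy
  diffeo t := ⟨hφ.isSmoothFoliatedMap t, fun x => ψ (x, t), fun x => hψφ x t, fun x => hφψ x t,
    hψ.isSmoothFoliatedMap t⟩
  zero := h0

end IsSmoothLeafwiseMotion

end SmoothFoliation

/-! ### Compactly supported pushes of Euclidean space -/

/-- A smooth family, parametrized by the ball of radius `r`, of maps of `E` into itself that are the
identity outside `K` and for the parameter `0`. -/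
structure IsSupportedFamily {E : Type*} [NormedAddCommGroup E] [NormedSpace ℝ E]
    (K : Set E) (r : ℝ) (H : E × E → E) : Prop where
  contDiffOn : ContDiffOn ℝ ∞ H (univ ×ˢ Metric.ball 0 r)
  eq_of_notMem : ∀ y u, u ∈ Metric.ball 0 r → y ∉ K → H (y, u) = y
  mapsTo : ∀ y u, u ∈ Metric.ball 0 r → y ∈ K → H (y, u) ∈ K
  zero : ∀ y, H (y, 0) = y

theorem mapsTo_of_injective_of_eq {E : Type*} {K : Set E} {f : E → E}
    (hf : Function.Injective f) (h : ∀ y, y ∉ K → f y = y) {y : E} (hy : y ∈ K) : f y ∈ K := by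
  by_contra hc
  exact hc (by rwa [hf (h _ hc)])

section Push

variable {E : Type*} [NormedAddCommGroup E] [NormedSpace ℝ E] [FiniteDimensional ℝ E]

/-- The map is the identity plus a perturbation with Lipschitz constant `C * ‖u‖ < 1`. -/
theorem bijective_add_smul {l : E → ℝ} {C : NNReal} (hl : LipschitzWith C l) {u : E}
    (hu : C * ‖u‖ < 1) : Function.Bijective (fun y => y + l y • u) := by
  -- The identity has norm 1 only on a nontrivial space; dimension zero is treated apart.
  rcases subsingleton_or_nontrivial E with hE | hE
  · exact ⟨fun _ _ _ => Subsingleton.elim _ _, fun z => ⟨z, Subsingleton.elim _ _⟩⟩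
  have happ : ApproximatesLinearOn (fun y => y + l y • u)
      ((ContinuousLinearEquiv.refl ℝ E : E ≃L[ℝ] E) : E →L[ℝ] E) univ (C * ‖u‖₊) := by
    intro x _ y _
    have h1 : x + l x • u - (y + l y • u) -
        ((ContinuousLinearEquiv.refl ℝ E : E ≃L[ℝ] E) : E →L[ℝ] E) (x - y) = (l x - l y) • u := by
      simp only [ContinuousLinearEquiv.coe_refl, ContinuousLinearMap.coe_id', id]
      rw [sub_smul]; abel
    rw [h1, norm_smul]
    have := hl.norm_sub_le x y
    calc ‖l x - l y‖ * ‖u‖ ≤ (C * ‖x - y‖) * ‖u‖ := by gcongr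
      _ = _ := by push_cast; ring
  refine (happ.toHomeomorph _ (Or.inr ?_)).bijective
  have h1 : ‖((ContinuousLinearEquiv.refl ℝ E).symm : E →L[ℝ] E)‖₊ = 1 := by
    simp
  rw [h1, inv_one]
  exact_mod_cast hu

/-- The inverse function theorem applied to `(y, u) ↦ (y + l y • u, u)` gives smoothness jointly in
the point and the parameter. No continuity of `Γ` is needed: injectivity for each fixed `u` forces
`Γ` to agree with the local inverse. -/
theorem contDiffAt_of_rightInverse_add_smul {l : E → ℝ} {C : NNReal} (hl : LipschitzWith C l)
    (hl' : ContDiff ℝ ∞ l) {r : ℝ} {Γ : E × E → E}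
    (hΓ : ∀ z u, u ∈ Metric.ball (0 : E) r → Γ (z, u) + l (Γ (z, u)) • u = z)
    {q : E × E} (hq : q.2 ∈ Metric.ball (0 : E) r) (hC : (C : ℝ) * ‖q.2‖ < 1) :
    ContDiffAt ℝ ∞ Γ q := by
  have hne : (∞ : WithTop ℕ∞) ≠ 0 := by simp
  set Φ : E × E → E × E := fun p => (p.1 + l p.1 • p.2, p.2) with hΦ
  have hΦs : ContDiff ℝ ∞ Φ :=
    (contDiff_fst.add ((hl'.comp contDiff_fst).smul contDiff_snd)).prodMk contDiff_snd
  set p : E × E := (Γ q, q.2) with hp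
  have hΦp : Φ p = q := Prod.ext (hΓ q.1 q.2 hq) rfl
  have hld : HasFDerivAt l (fderiv ℝ l p.1) p.1 := (hl'.differentiable hne p.1).hasFDerivAt
  have hd := ((hasFDerivAt_fst (𝕜 := ℝ) (p := p)).add
    ((hld.comp p hasFDerivAt_fst).smul (hasFDerivAt_snd (p := p)))).prodMk (hasFDerivAt_snd (p := p))
  have hinj : Function.Injective (fderiv ℝ Φ p) := by
    have hfd : fderiv ℝ Φ p = _ := hd.fderiv
    rw [hfd]
    refine (injective_iff_map_eq_zero _).2 ?_
    rintro ⟨a, b⟩ hab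
    simp only [ContinuousLinearMap.prod_apply, _root_.add_apply,
      _root_.smul_apply, ContinuousLinearMap.smulRight_apply, Prod.mk_eq_zero,
      ContinuousLinearMap.coe_fst', ContinuousLinearMap.coe_snd',
      ContinuousLinearMap.comp_apply, Function.comp_apply] at hab
    obtain ⟨h1, rfl⟩ := hab
    simp only [smul_zero, zero_add] at h1
    -- A kernel vector `(a, 0)` satisfies `a = -(dl a) • u`, and `dl` has norm at most `C`.
    have h2 : ‖a‖ ≤ C * ‖q.2‖ * ‖a‖ := by
      calc ‖a‖ = ‖(fderiv ℝ l p.1 a) • p.2‖ := by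
            rw [← norm_neg (_ • _), ← eq_neg_of_add_eq_zero_left h1]
        _ = ‖fderiv ℝ l p.1 a‖ * ‖q.2‖ := norm_smul _ _
        _ ≤ (C * ‖a‖) * ‖q.2‖ := by
            gcongr
            exact (fderiv ℝ l p.1).le_of_opNorm_le (norm_fderiv_le_of_lipschitz ℝ hl) a
        _ = _ := by ring
    have h3 : ‖a‖ = 0 := by nlinarith [norm_nonneg a]
    simp [norm_eq_zero.1 h3]
  let e : (E × E) ≃L[ℝ] (E × E) :=
    (LinearEquiv.ofInjectiveEndo (fderiv ℝ Φ p : E × E →ₗ[ℝ] E × E) hinj).toContinuousLinearEquiv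
  have he : HasFDerivAt Φ (e : E × E →L[ℝ] E × E) p := by
    have : (e : E × E →L[ℝ] E × E) = fderiv ℝ Φ p := by ext x <;> rfl
    rw [this]
    exact (hΦs.differentiable hne p).hasFDerivAt
  have hat : ContDiffAt ℝ ∞ Φ p := hΦs.contDiffAt
  have hinv := hat.to_localInverse he hne
  have hright := (hat.hasStrictFDerivAt' he hne).eventually_right_inverse
  rw [hΦp] at hinv hright
  refine (contDiffAt_fst.comp q hinv).congr_of_eventuallyEq ?_
  have hball : ∀ᶠ q' in 𝓝 q, q'.2 ∈ Metric.ball (0 : E) r ∧ (C : ℝ) * ‖q'.2‖ < 1 :=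
    (continuousAt_snd.eventually_mem (Metric.isOpen_ball.mem_nhds hq)).and
      ((by fun_prop : Continuous fun q' : E × E => (C : ℝ) * ‖q'.2‖).continuousAt.eventually_lt
        continuousAt_const hC)
  filter_upwards [hright, hball] with q' h1 h2
  obtain ⟨h3, h4⟩ := Prod.ext_iff.1 h1
  refine (bijective_add_smul hl h2.2).1 ?_
  have h5 := hΓ q'.1 q'.2 h2.1
  simp only [hΦ] at h3 h4
  rw [h4] at h3
  exact h5.trans h3.symm

theorem exists_isSupportedFamily_push [HasContDiffBump E] (y₀ : E) {ε : ℝ} (hε : 0 < ε) :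
    ∃ r > 0, ∃ H Γ : E × E → E, IsSupportedFamily (Metric.closedBall y₀ (2 * ε)) r H ∧
      IsSupportedFamily (Metric.closedBall y₀ (2 * ε)) r Γ ∧
      (∀ y u, u ∈ Metric.ball 0 r → Γ (H (y, u), u) = y) ∧
      (∀ y u, u ∈ Metric.ball 0 r → H (Γ (y, u), u) = y) ∧
      ∀ y u, y ∈ Metric.closedBall y₀ ε → H (y, u) = y + u := by
  have hne : (∞ : WithTop ℕ∞) ≠ 0 := by simp
  let l : ContDiffBump y₀ := ⟨ε, 2 * ε, hε, by linarith⟩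
  have hls : ContDiff ℝ ∞ l := l.contDiff
  obtain ⟨C, hC⟩ := hls.lipschitzWith_of_hasCompactSupport l.hasCompactSupport hne
  -- This radius ensures `C * ‖u‖ < 1`; adding 1 also covers `C = 0`.
  set r : ℝ := 1 / (C + 1) with hr
  have hC0 : (0 : ℝ) ≤ C := C.2
  have hr0 : 0 < r := by positivity
  have hCu : ∀ u ∈ Metric.ball (0 : E) r, (C : ℝ) * ‖u‖ < 1 := by
    intro u hu
    have h1 : ‖u‖ < r := by simpa using hu
    have h2 : (C + 1 : ℝ) * r = 1 := by rw [hr]; field_simp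
    nlinarith [norm_nonneg u]
  have hbij := fun u hu => bijective_add_smul hC (hCu u hu)
  let Γ : E × E → E := fun q => Function.invFun (fun y => y + l y • q.2) q.1
  have hleft : ∀ y u, u ∈ Metric.ball (0 : E) r → Γ (y + l y • u, u) = y := fun y u hu =>
    Function.leftInverse_invFun (hbij u hu).1 y
  have hright : ∀ z u, u ∈ Metric.ball (0 : E) r → Γ (z, u) + l (Γ (z, u)) • u = z :=
    fun z u hu => Function.rightInverse_invFun (hbij u hu).2 z
  have hoff : ∀ y u, y ∉ Metric.closedBall y₀ (2 * ε) → y + l y • u = y := by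
    intro y u hy
    rw [l.zero_of_le_dist (by simpa using (not_le.1 hy).le), zero_smul, add_zero]
  have hoff' : ∀ y u, u ∈ Metric.ball (0 : E) r → y ∉ Metric.closedBall y₀ (2 * ε) →
      Γ (y, u) = y := by
    intro y u hu hy
    conv_lhs => rw [← hoff y u hy]
    exact hleft y u hu
  refine ⟨r, hr0, fun p => p.1 + l p.1 • p.2, Γ, ⟨?_, fun y u _ hy => hoff y u hy, ?_, by simp⟩,
    ⟨?_, hoff', ?_, ?_⟩, hleft, hright, ?_⟩
  · exact (contDiff_fst.add ((hls.comp contDiff_fst).smul contDiff_snd)).contDiffOn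
  · exact fun y u hu hy => mapsTo_of_injective_of_eq (hbij u hu).1 (fun y => hoff y u) hy
  · exact fun q hq => (contDiffAt_of_rightInverse_add_smul hC hls hright hq.2
      (hCu _ hq.2)).contDiffWithinAt
  · intro y u hu hy
    exact mapsTo_of_injective_of_eq (f := fun y => Γ (y, u))
      (Function.LeftInverse.injective (g := fun z => z + l z • u) fun z => hright z u hu)
      (fun y => hoff' y u hu) hy
  · intro y
    simpa using hright y 0 (Metric.mem_ball_self hr0)
  · intro y u hy
    simp only [l.one_of_mem_closedBall hy, one_smul]

end Push

/-! ### Boxes and transverse cutoffs -/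

namespace FoliatedChart

variable {X : Type u} [TopologicalSpace X] {n : ℕ}

/-- The part of the chart domain with leafwise coordinates in `K` and transverse coordinate
in `M`. -/
def box (e : FoliatedChart X n) (K : Set (EuclideanSpace ℝ (Fin n))) (M : Set e.T) : Set X :=
  {x | x ∈ e.source ∧ e.coord x ∈ K ∧ e.proj x ∈ M}

theorem box_eq_image {e : FoliatedChart X n} {K : Set (EuclideanSpace ℝ (Fin n))} (hK : K ⊆ e.B)
    (M : Set e.T) : e.box K M = e.toHomeo.symm '' (K ×ˢ M) := by
  ext x
  constructor
  · rintro ⟨hx, h1, h2⟩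
    exact ⟨(e.coord x, e.proj x), ⟨h1, h2⟩, e.inv_coord_proj hx⟩
  · rintro ⟨⟨y, w⟩, ⟨h1, h2⟩, rfl⟩
    exact ⟨inv_mem (hK h1) w, by rwa [← coord_inv (hK h1) w] at h1,
      by rwa [← proj_inv (hK h1) w] at h2⟩

theorem isCompact_box {e : FoliatedChart X n} {K : Set (EuclideanSpace ℝ (Fin n))} {M : Set e.T}
    (hK : IsCompact K) (hM : IsCompact M) (hKB : K ⊆ e.B) : IsCompact (e.box K M) := by
  rw [box_eq_image hKB]
  refine (hK.prod hM).image_of_continuousOn (e.toHomeo.continuousOn_symm.mono ?_)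
  rintro ⟨y, w⟩ ⟨hy, -⟩
  exact e.mem_target (hKB hy) w

/-- No separation property of `e.T` is assumed, so the cutoff is a Urysohn function of the compact
Hausdorff space `X`, restricted to the transversal through `x₀`. The set `M` is the projection of a
compact neighbourhood of `x₀`; the box is then compact, hence closed in all of `X`. -/
theorem exists_transverse_cutoff [CompactSpace X] [T2Space X] (e : FoliatedChart X n) {x₀ : X}
    (hx₀ : x₀ ∈ e.source) {U : Set X} (hU : U ∈ 𝓝 x₀) :
    ∃ ε > 0, Metric.closedBall (e.coord x₀) (2 * ε) ⊆ e.B ∧ ∃ (M : Set e.T) (μ : e.T → ℝ),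
      Continuous μ ∧ (∀ w, μ w ∈ Icc 0 1) ∧ μ (e.proj x₀) = 1 ∧ (∀ w, w ∉ M → μ w = 0) ∧
      IsClosed (e.box (Metric.closedBall (e.coord x₀) (2 * ε)) M) ∧
      e.box (Metric.closedBall (e.coord x₀) (2 * ε)) M ⊆ U := by
  have hB := e.coord_mem hx₀
  have hev : ∀ᶠ p in 𝓝 (e.coord x₀, e.proj x₀), p.1 ∈ e.B ∧ e.inv p.1 p.2 ∈ U := by
    refine (continuousAt_fst.eventually_mem (e.isOpen_B.mem_nhds hB)).and ?_
    refine (continuousAt_inv hB (e.proj x₀)).eventually_mem ?_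
    simpa only [e.inv_coord_proj hx₀] using hU
  rw [nhds_prod_eq, Filter.eventually_prod_iff] at hev
  obtain ⟨P, hP, W, hW, hPW⟩ := hev
  obtain ⟨δ, hδ, hball⟩ := Metric.eventually_nhds_iff_ball.1 hP
  have hsub : ∀ y ∈ Metric.closedBall (e.coord x₀) (2 * (δ / 4)), P y := fun y hy =>
    hball y (Metric.closedBall_subset_ball (by linarith) hy)
  have hsubB : Metric.closedBall (e.coord x₀) (2 * (δ / 4)) ⊆ e.B := fun y hy =>
    (hPW (hsub y hy) hW.self_of_nhds).1
  have hN : {x | x ∈ e.source ∧ W (e.proj x)} ∈ 𝓝 x₀ :=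
    (e.isOpen_source.eventually_mem hx₀).and ((continuousAt_proj hx₀).eventually hW)
  obtain ⟨Q, hQ, hQN, hQc⟩ := local_compact_nhds hN
  obtain ⟨m, hm0, hm1, hm⟩ := exists_continuous_zero_one_of_isClosed
    (isOpen_interior (s := Q)).isClosed_compl (isClosed_singleton (x := x₀))
    (disjoint_singleton_right.2 (not_not.2 (mem_interior_iff_mem_nhds.2 hQ)))
  have hM : IsCompact (e.proj '' Q) := hQc.image_of_continuousOn fun x hx =>
    (continuousAt_proj (hQN hx).1).continuousWithinAt
  refine ⟨δ / 4, by linarith, hsubB, e.proj '' Q, fun w => m (e.inv (e.coord x₀) w), ?_,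
    fun w => hm _, ?_, ?_, ?_, ?_⟩
  · refine m.continuous.comp (continuous_iff_continuousAt.2 fun w => ?_)
    exact ContinuousAt.comp (f := fun w : e.T => (e.coord x₀, w)) (continuousAt_inv hB w)
      (by fun_prop)
  · simpa only [e.inv_coord_proj hx₀, Pi.one_apply] using hm1 (mem_singleton x₀)
  · intro w hw
    refine hm0 fun hmem => hw ⟨_, interior_subset hmem, proj_inv hB w⟩
  · exact (isCompact_box (isCompact_closedBall _ _) hM hsubB).isClosed
  · rintro x ⟨hx, h1, x', hx', h2⟩
    have := (hPW (hsub _ h1) (h2 ▸ (hQN hx').2)).2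
    rwa [e.inv_coord_proj hx] at this

end FoliatedChart

/-! ### Pushes inside one chart, extended by the identity -/

namespace SmoothFoliation

variable {X : Type u} [TopologicalSpace X] {n : ℕ} {F : SmoothFoliation X n}

/-- A plaque is the image of the contractible set `e.B` under a map that is continuous for the leaf
topology, so it is connected there. -/
theorem mem_connectedComponent_of_proj_eq (F : SmoothFoliation X n) {e : FoliatedChart X n}
    (he : e ∈ F.charts) {x y : X} (hx : x ∈ e.source) (hy : y ∈ e.source)
    (hxy : e.proj y = e.proj x) : y ∈ @connectedComponent X F.leafTopology x := by
  set w := e.proj x with hw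
  let m : e.B → e.plaque w := fun a =>
    ⟨e.inv a w, FoliatedChart.inv_mem a.2 w, FoliatedChart.proj_inv a.2 w⟩
  have hm : Continuous m := by
    refine Continuous.subtype_mk (continuous_iff_continuousAt.2 fun a => ?_) _
    exact ContinuousAt.comp (f := fun a : e.B => ((a : EuclideanSpace ℝ (Fin n)), w))
      (FoliatedChart.continuousAt_inv a.2 w) (by fun_prop)
  have hc : Continuous[inferInstance, F.leafTopology] (fun a : e.B => e.inv a w) := by
    refine continuous_generateFrom_iff.2 ?_
    rintro s ⟨e', he', w', O, hO, rfl⟩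
    exact (hO.preimage (continuous_subtype_val.comp hm)).inter
      ((F.plaque_inter e he e' he' w w').preimage hm)
  have hB : ContractibleSpace e.B := e.contractible_B
  have hr := @isPreconnected_range e.B X _ F.leafTopology _ _ hc
  have hxm : x ∈ range (fun a : e.B => e.inv a w) :=
    ⟨⟨e.coord x, e.coord_mem hx⟩, e.inv_coord_proj hx⟩
  have hym : y ∈ range (fun a : e.B => e.inv a w) :=
    ⟨⟨e.coord y, e.coord_mem hy⟩, by simp only [← hxy, e.inv_coord_proj hy]⟩
  exact (@IsPreconnected.subset_connectedComponent X F.leafTopology _ _ hr hxm) hym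

open Classical in
/-- The homotopy that acts on the plaques of `e` by the maps `H (·, μ v)`, where `μ` is a function
of the transverse coordinate and `v` a function of time. -/
def chartPush (e : FoliatedChart X n)
    (H : EuclideanSpace ℝ (Fin n) × EuclideanSpace ℝ (Fin n) → EuclideanSpace ℝ (Fin n))
    (μ : e.T → ℝ) (v : ℝ → EuclideanSpace ℝ (Fin n)) (q : X × I) : X :=
  if q.1 ∈ e.source then e.inv (H (e.coord q.1, μ (e.proj q.1) • v q.2)) (e.proj q.1) else q.1

section ChartPush

variable {e : FoliatedChart X n}
  {H Γ : EuclideanSpace ℝ (Fin n) × EuclideanSpace ℝ (Fin n) → EuclideanSpace ℝ (Fin n)}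
  {μ : e.T → ℝ} {v : ℝ → EuclideanSpace ℝ (Fin n)} {K : Set (EuclideanSpace ℝ (Fin n))}
  {M : Set e.T} {r : ℝ}

theorem chartPush_of_mem {q : X × I} (hq : q.1 ∈ e.source) :
    chartPush e H μ v q = e.inv (H (e.coord q.1, μ (e.proj q.1) • v q.2)) (e.proj q.1) :=
  if_pos hq

theorem smul_mem_ball {E : Type*} [NormedAddCommGroup E] [NormedSpace ℝ E] {r s : ℝ} {u : E}
    (hs : s ∈ Icc (0 : ℝ) 1) (hu : u ∈ Metric.ball (0 : E) r) : s • u ∈ Metric.ball (0 : E) r := by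
  rw [mem_ball_zero_iff] at hu ⊢
  rw [norm_smul, Real.norm_of_nonneg hs.1]
  nlinarith [hs.2, norm_nonneg u]

theorem _root_.IsSupportedFamily.mem_of_subset {E : Type*} [NormedAddCommGroup E]
    [NormedSpace ℝ E] {K B : Set E} {r : ℝ} {H : E × E → E} (hH : IsSupportedFamily K r H)
    (hKB : K ⊆ B) {y u : E} (hy : y ∈ B) (hu : u ∈ Metric.ball (0 : E) r) : H (y, u) ∈ B := by
  by_cases hK : y ∈ K
  · exact hKB (hH.mapsTo y u hu hK)
  · rwa [hH.eq_of_notMem y u hu hK]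

theorem chartPush_eq_of_eq_zero (hH : IsSupportedFamily K r H) {q : X × I}
    (h : v q.2 = 0) : chartPush e H μ v q = q.1 := by
  by_cases hq : q.1 ∈ e.source
  · rw [chartPush_of_mem hq, h, smul_zero, hH.zero, e.inv_coord_proj hq]
  · exact if_neg hq

theorem chartPush_eq_of_notMem_box (hH : IsSupportedFamily K r H) (hμ : ∀ w, μ w ∈ Icc (0 : ℝ) 1)
    (hM : ∀ w, w ∉ M → μ w = 0) (hv : ∀ t ∈ Icc (0 : ℝ) 1, v t ∈ Metric.ball 0 r) {q : X × I}
    (hq : q.1 ∉ e.box K M) : chartPush e H μ v q = q.1 := by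
  by_cases hs : q.1 ∈ e.source
  · rw [chartPush_of_mem hs]
    by_cases hK : e.coord q.1 ∈ K
    · have : e.proj q.1 ∉ M := fun h => hq ⟨hs, hK, h⟩
      rw [hM _ this, zero_smul, hH.zero, e.inv_coord_proj hs]
    · rw [hH.eq_of_notMem _ _ (smul_mem_ball (hμ _) (hv _ q.2.2)) hK, e.inv_coord_proj hs]
  · exact if_neg hs

theorem chartPush_chartPush (hH : IsSupportedFamily K r H) (hKB : K ⊆ e.B)
    (hμ : ∀ w, μ w ∈ Icc (0 : ℝ) 1) (hv : ∀ t ∈ Icc (0 : ℝ) 1, v t ∈ Metric.ball 0 r)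
    (hΓ : ∀ y u, u ∈ Metric.ball 0 r → Γ (H (y, u), u) = y) (x : X) (t : I) :
    chartPush e Γ μ v (chartPush e H μ v (x, t), t) = x := by
  by_cases hs : x ∈ e.source
  · have hu := smul_mem_ball (hμ (e.proj x)) (hv _ t.2)
    have hB := hH.mem_of_subset hKB (e.coord_mem hs) hu
    rw [chartPush_of_mem (q := (x, t)) hs, chartPush_of_mem (FoliatedChart.inv_mem hB _)]
    simp only [FoliatedChart.coord_inv hB, FoliatedChart.proj_inv hB]
    rw [hΓ _ _ hu, e.inv_coord_proj hs]
  · have h1 : chartPush e H μ v (x, t) = x := if_neg hs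
    rw [h1]
    exact if_neg hs

theorem isSmoothLeafwiseMotion_chartPush (he : e ∈ F.charts) (hH : IsSupportedFamily K r H)
    (hKB : K ⊆ e.B) (hbox : IsClosed (e.box K M)) (hμ : ∀ w, μ w ∈ Icc (0 : ℝ) 1)
    (hμc : Continuous μ) (hM : ∀ w, w ∉ M → μ w = 0)
    (hv : ∀ t ∈ Icc (0 : ℝ) 1, v t ∈ Metric.ball 0 r) (hvs : ContDiffOn ℝ ∞ v (Icc 0 1)) :
    F.IsSmoothLeafwiseMotion (chartPush e H μ v) := by
  -- The chart domain and the complement of the closed box form an open cover; on the second set the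
  -- push is stationary, so every property is local in one of two cases.
  have hcases : ∀ q : X × I, q.1 ∈ e.source ∨ ∀ᶠ q' in 𝓝 q, chartPush e H μ v q' = q'.1 := by
    intro q
    by_cases hq : q.1 ∈ e.box K M
    · exact Or.inl hq.1
    · right
      filter_upwards [continuousAt_fst.eventually_mem (hbox.isOpen_compl.mem_nhds hq)] with q' hq'
      exact chartPush_eq_of_notMem_box hH hμ hM hv hq'
  have hball : ∀ w t, t ∈ Icc (0 : ℝ) 1 → μ w • v t ∈ Metric.ball 0 r := fun w t ht =>
    smul_mem_ball (hμ w) (hv t ht)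
  have hHB : ∀ q : X × I, q.1 ∈ e.source → H (e.coord q.1, μ (e.proj q.1) • v q.2) ∈ e.B :=
    fun q hq => hH.mem_of_subset hKB (e.coord_mem hq) (hball _ _ q.2.2)
  have hmem : ∀ q : X × I, q.1 ∈ e.source → chartPush e H μ v q ∈ e.source := by
    intro q hq
    rw [chartPush_of_mem hq]
    exact FoliatedChart.inv_mem (hHB q hq) _
  have hproj : ∀ q : X × I, q.1 ∈ e.source → e.proj (chartPush e H μ v q) = e.proj q.1 := by
    intro q hq
    rw [chartPush_of_mem hq]
    exact FoliatedChart.proj_inv (hHB q hq) _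
  have hsrc : ∀ q : X × I, q.1 ∈ e.source → ∀ᶠ q' in 𝓝 q, q'.1 ∈ e.source := fun q hq =>
    continuousAt_fst.eventually_mem (e.isOpen_source.mem_nhds hq)
  have hvc : Continuous fun t : I => v t := hvs.continuousOn.domRestrict
  refine ⟨continuous_iff_continuousAt.2 fun q => ?_, fun q => ?_, fun q => ?_⟩
  · rcases hcases q with hq | hq
    · have hp := (FoliatedChart.continuousAt_proj hq).comp (continuousAt_fst (p := q))
      have hco := (FoliatedChart.continuousAt_coord hq).comp (continuousAt_fst (p := q))
      have hHc : ContinuousAt H (e.coord q.1, μ (e.proj q.1) • v q.2) :=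
        hH.contDiffOn.continuousOn.continuousAt
          ((isOpen_univ.prod Metric.isOpen_ball).mem_nhds ⟨mem_univ _, hball _ _ q.2.2⟩)
      have hu : ContinuousAt (fun q : X × I => μ (e.proj q.1) • v q.2) q :=
        (hμc.continuousAt.comp hp).smul (hvc.comp continuous_snd).continuousAt
      have h1 := (FoliatedChart.continuousAt_inv (hHB q hq) (e.proj q.1)).comp_of_eq
        (f := fun q : X × I => (H (e.coord q.1, μ (e.proj q.1) • v q.2), e.proj q.1))
        ((hHc.comp_of_eq (hco.prodMk hu) rfl).prodMk hp) rfl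
      refine h1.congr ?_
      filter_upwards [hsrc q hq] with q' hq'
      exact (chartPush_of_mem hq').symm
    · exact continuousAt_fst.congr (hq.mono fun _ h => h.symm)
  · rcases hcases q with hq | hq
    · exact F.mem_connectedComponent_of_proj_eq he hq (hmem q hq) (hproj q hq)
    · rw [hq.self_of_nhds]
      exact @mem_connectedComponent X F.leafTopology q.1
  · rcases hcases q with hq | hq
    · refine ⟨e, he, e, he, hq, hmem q hq, ⟨id, (hsrc q hq).mono fun q' hq' => hproj q' hq'⟩, ?_⟩
      have hS : (((e.coord q.1, (q.2 : ℝ)), e.proj q.1) :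
          (EuclideanSpace ℝ (Fin n) × ℝ) × e.T).1 ∈
          (univ : Set (EuclideanSpace ℝ (Fin n))) ×ˢ Icc (0 : ℝ) 1 := ⟨mem_univ _, q.2.2⟩
      -- The last variable stands for the value of the cutoff `μ`, inserted through `of_parameter`.
      have hg : ContDiffOn ℝ ∞ (fun p : (EuclideanSpace ℝ (Fin n) × ℝ) × ℝ =>
          H (p.1.1, p.2 • v p.1.2)) ((univ ×ˢ Icc 0 1) ×ˢ Icc 0 1) := by
        have h1 : ContDiffOn ℝ ∞ (fun p : (EuclideanSpace ℝ (Fin n) × ℝ) × ℝ => v p.1.2)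
            ((univ ×ˢ Icc 0 1) ×ˢ Icc 0 1) :=
          hvs.comp (contDiff_snd.comp contDiff_fst).contDiffOn fun p hp => hp.1.2
        refine hH.contDiffOn.comp ((contDiff_fst.comp contDiff_fst).contDiffOn.prodMk
          (contDiff_snd.contDiffOn.smul h1)) fun p hp => ⟨mem_univ _, ?_⟩
        exact smul_mem_ball hp.2 (hv _ hp.1.2)
      have h1 := LeafwiseSmoothAt.of_parameter (p := ((e.coord q.1, (q.2 : ℝ)), e.proj q.1))
        (uniqueDiffOn_univ_prod_Icc (n := n)) (uniqueDiffOn_Icc zero_lt_one) hS hg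
        hμc.continuousAt hμ
      refine h1.congr hS ?_
      have hB : ∀ᶠ p in 𝓝 (((e.coord q.1, (q.2 : ℝ)), e.proj q.1) :
          (EuclideanSpace ℝ (Fin n) × ℝ) × e.T), p.1.1 ∈ e.B :=
        (continuous_fst.comp continuous_fst).continuousAt.eventually_mem
          (e.isOpen_B.mem_nhds (e.coord_mem hq))
      filter_upwards [mem_nhdsWithin_of_mem_nhds hB, self_mem_nhdsWithin] with p hp hpS
      simp only [localRep]
      rw [chartPush_of_mem (FoliatedChart.inv_mem hp _)]
      simp only [FoliatedChart.coord_inv hp, FoliatedChart.proj_inv hp,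
        projIcc_of_mem zero_le_one hpS.1.2]
      exact FoliatedChart.coord_inv (hH.mem_of_subset hKB hp (hball _ _ hpS.1.2)) _
    · obtain ⟨e₁, he₁, hq₁⟩ := F.cover q.1
      exact ⟨e₁, he₁, e₁, he₁, (F.chartSmoothAt_fst he₁ he₁ hq₁ hq₁).congr hq⟩

end ChartPush

end SmoothFoliation

/-! ### Following the path piece by piece -/

namespace SmoothFoliation

variable {X : Type u} [TopologicalSpace X] {n : ℕ} {F : SmoothFoliation X n}

/-- A smooth leafwise motion `φ` supported in `U`, starting at the identity, with inverse `ψ`. -/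
structure IsInvertibleMotion (F : SmoothFoliation X n) (U : Set X) (φ ψ : X × I → X) : Prop where
  motion : F.IsSmoothLeafwiseMotion φ
  motion_inv : F.IsSmoothLeafwiseMotion ψ
  left_inv : ∀ x t, ψ (φ (x, t), t) = x
  right_inv : ∀ x t, φ (ψ (x, t), t) = x
  zero : ∀ x, φ (x, 0) = x
  support : ∃ K, IsClosed K ∧ K ⊆ U ∧ ∀ x, x ∉ K → ∀ t, φ (x, t) = x

namespace IsInvertibleMotion

variable {U : Set X} {φ ψ φ' ψ' : X × I → X}

theorem fst (F : SmoothFoliation X n) (U : Set X) : F.IsInvertibleMotion U Prod.fst Prod.fst where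
  motion := .fst F
  motion_inv := .fst F
  left_inv _ _ := rfl
  right_inv _ _ := rfl
  zero _ := rfl
  support := ⟨∅, isClosed_empty, empty_subset _, fun _ _ _ => rfl⟩

theorem comp (h' : F.IsInvertibleMotion U φ' ψ') (h : F.IsInvertibleMotion U φ ψ) :
    F.IsInvertibleMotion U (fun q => φ' (φ q, q.2)) (fun q => ψ (ψ' q, q.2)) where
  motion := h'.motion.comp h.motion
  motion_inv := h.motion_inv.comp h'.motion_inv
  left_inv x t := by simp only [h'.left_inv, h.left_inv]
  right_inv x t := by simp only [h.right_inv, h'.right_inv]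
  zero x := by simp only [h.zero, h'.zero]
  support := by
    obtain ⟨K, hK, hKU, hφ⟩ := h.support
    obtain ⟨K', hK', hKU', hφ'⟩ := h'.support
    refine ⟨K ∪ K', hK.union hK', union_subset hKU hKU', fun x hx t => ?_⟩
    rw [mem_union, not_or] at hx
    simp only [hφ x hx.1, hφ' x hx.2]

theorem diffeotopySupport_subset (h : F.IsInvertibleMotion U φ ψ) : diffeotopySupport φ ⊆ U := by
  obtain ⟨K, hK, hKU, hφ⟩ := h.support
  refine (closure_minimal ?_ hK).trans hKU
  rintro x ⟨t, ht⟩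
  by_contra hx
  exact ht (hφ x hx t)

end IsInvertibleMotion

/-- Near every time `r₀`, the path `c` can be followed by motions supported near `c r₀`. -/
theorem exists_isInvertibleMotion_near [CompactSpace X] [T2Space X] (F : SmoothFoliation X n)
    {c : I → X} (hc : F.IsSmoothLeafPath c) {U : Set X} (hU : IsOpen U) (hcU : range c ⊆ U)
    (r₀ : ℝ) :
    ∃ O : Set ℝ, IsOpen O ∧ r₀ ∈ O ∧ ∀ τ τ' : ℝ → ℝ, ContDiff ℝ ∞ τ → ContDiff ℝ ∞ τ' →
      MapsTo τ (Icc 0 1) (Icc 0 1) → MapsTo τ' (Icc 0 1) (Icc 0 1) → τ 0 = τ' 0 →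
      (∀ t ∈ Icc (0 : ℝ) 1, (τ t ∈ O ∧ τ' t ∈ O) ∨ ∀ᶠ s in 𝓝 t, τ s = τ' s) →
      ∃ φ ψ : X × I → X, F.IsInvertibleMotion U φ ψ ∧
        ∀ t : I, φ (c (projIcc 0 1 zero_le_one (τ t)), t) =
          c (projIcc 0 1 zero_le_one (τ' t)) := by
  set d : ℝ → X := fun r => c (projIcc 0 1 zero_le_one r) with hd
  obtain ⟨e, he, hx₀⟩ := F.cover (d r₀)
  obtain ⟨ε, hε, hKB, M, μ, hμc, hμ, hμ1, hM, hbox, hboxU⟩ := e.exists_transverse_cutoff hx₀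
    (hU.mem_nhds (hcU ⟨_, rfl⟩))
  obtain ⟨r, hr, H, Γ, hH, hΓ, hΓH, hHΓ, hHadd⟩ :=
    exists_isSupportedFamily_push (e.coord (d r₀)) hε
  set a : ℝ → EuclideanSpace ℝ (Fin n) := fun r => e.coord (d r) with ha
  have has : ∀ t ∈ Icc (0 : ℝ) 1, d t ∈ e.source → ContDiffWithinAt ℝ ∞ a (Icc 0 1) t := by
    intro t ht hs
    refine hc.2 e he ⟨t, ht⟩ ?_
    simpa only [hd, projIcc_of_mem zero_le_one ht] using hs
  -- Plaques are open for the leaf topology, so near `r₀` the path stays in a single plaque, where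
  -- `μ = 1`.
  have hplaque : ∀ᶠ s in 𝓝 r₀, d s ∈ e.plaque (e.proj (d r₀)) := by
    have hdc : Continuous[inferInstance, F.leafTopology] d :=
      @Continuous.comp ℝ I X _ _ F.leafTopology _ _ hc.1 continuous_projIcc
    have ho : IsOpen (d ⁻¹' (univ ∩ e.plaque (e.proj (d r₀)))) :=
      @IsOpen.preimage ℝ X _ F.leafTopology _ hdc _
        (TopologicalSpace.isOpen_generateFrom_of_mem ⟨e, he, _, univ, isOpen_univ, rfl⟩)
    rw [univ_inter] at ho
    exact ho.mem_nhds ⟨hx₀, rfl⟩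
  -- Within `ε` of the centre the push is an exact translation; `r / 2` keeps differences of two
  -- such points in the parameter ball.
  have hclose : ∀ᶠ s in 𝓝 r₀, a s ∈ Metric.ball (e.coord (d r₀)) (min ε (r / 2)) := by
    have hac : ContinuousAt a r₀ := by
      have h1 : ContinuousWithinAt a (Icc 0 1) (projIcc (0 : ℝ) 1 zero_le_one r₀) := by
        refine (has _ (projIcc 0 1 zero_le_one r₀).2 ?_).continuousWithinAt
        simpa only [hd, projIcc_val] using hx₀
      have h2 : Tendsto (fun s => ((projIcc (0 : ℝ) 1 zero_le_one s : I) : ℝ)) (𝓝 r₀)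
          (𝓝[Icc 0 1] (projIcc (0 : ℝ) 1 zero_le_one r₀ : I)) :=
        tendsto_nhdsWithin_iff.2 ⟨(continuous_subtype_val.comp continuous_projIcc).tendsto r₀,
          Eventually.of_forall fun s => (projIcc 0 1 zero_le_one s).2⟩
      have h3 := h1.tendsto.comp h2
      simp only [Function.comp_def, ha, hd, projIcc_val] at h3
      exact h3
    exact hac.eventually_mem (Metric.ball_mem_nhds _ (by positivity))
  obtain ⟨O, hO, hOo, hOmem⟩ := eventually_nhds_iff.1 (hplaque.and hclose)
  refine ⟨O, hOo, hOmem, fun τ τ' hτ hτ' hmap hmap' h0 hττ' => ?_⟩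
  set v : ℝ → EuclideanSpace ℝ (Fin n) := fun t => a (τ' t) - a (τ t) with hv
  have hvball : ∀ t ∈ Icc (0 : ℝ) 1, v t ∈ Metric.ball 0 r := by
    intro t ht
    rcases hττ' t ht with ⟨h1, h2⟩ | h
    · have h1 := (hO _ h1).2
      have h2 := (hO _ h2).2
      have h3 := dist_triangle_right (a (τ' t)) (a (τ t)) (e.coord (d r₀))
      rw [Metric.mem_ball] at h1 h2
      have h4 := min_le_right ε (r / 2)
      rw [mem_ball_zero_iff, hv, ← dist_eq_norm]
      linarith
    · simpa [hv, h.self_of_nhds] using hr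
  have hvs : ContDiffOn ℝ ∞ v (Icc 0 1) := by
    intro t ht
    -- In the second case the path may be outside the chart, where `a` is meaningless; but `v`
    -- vanishes near `t`, so it is still smooth.
    rcases hττ' t ht with ⟨h1, h2⟩ | h
    · exact ((has _ (hmap' ht) (hO _ h2).1.1).comp t hτ'.contDiffWithinAt hmap').sub
        ((has _ (hmap ht) (hO _ h1).1.1).comp t hτ.contDiffWithinAt hmap)
    · have hz : ∀ᶠ s in 𝓝 t, v s = 0 := h.mono fun s hs => by simp [hv, hs]
      exact contDiffWithinAt_const.congr_of_eventuallyEq (mem_nhdsWithin_of_mem_nhds hz)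
        hz.self_of_nhds
  refine ⟨chartPush e H μ v, chartPush e Γ μ v,
    ⟨isSmoothLeafwiseMotion_chartPush he hH hKB hbox hμ hμc hM hvball hvs,
      isSmoothLeafwiseMotion_chartPush he hΓ hKB hbox hμ hμc hM hvball hvs,
      chartPush_chartPush hH hKB hμ hvball hΓH, chartPush_chartPush hΓ hKB hμ hvball hHΓ,
      fun x => chartPush_eq_of_eq_zero hH (by simp [hv, h0]), _, hbox, hboxU,
      fun x hx t => chartPush_eq_of_notMem_box hH hμ hM hvball hx⟩, fun t => ?_⟩
  rcases hττ' t t.2 with ⟨h1, h2⟩ | h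
  · obtain ⟨⟨hs, hp⟩, hb⟩ := hO _ h1
    obtain ⟨⟨hs', hp'⟩, -⟩ := hO _ h2
    have hcl : a (τ t) ∈ Metric.closedBall (e.coord (d r₀)) ε :=
      Metric.ball_subset_closedBall (Metric.ball_subset_ball (min_le_left _ _) hb)
    have h3 : H (a (τ t), v t) = a (τ' t) := by
      rw [hHadd _ _ hcl, hv]; exact add_sub_cancel _ _
    change chartPush e H μ v (d (τ t), t) = d (τ' t)
    rw [chartPush_of_mem (q := (d (τ t), t)) hs]
    simp only
    rw [hp, hμ1, one_smul]
    change e.inv (H (a (τ t), v t)) _ = _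
    rw [h3, ← hp']
    exact e.inv_coord_proj hs'
  · rw [chartPush_eq_of_eq_zero hH (by simp [hv, h.self_of_nhds]), h.self_of_nhds]

/-! ### Smooth clocks and the induction along the path -/

/-- A smooth function that is the identity up to `b - h` and has the value `b` from `b` on. -/
def clampAt (h b t : ℝ) : ℝ := t + (b - t) * Real.smoothTransition ((t - b) / h + 1)

theorem contDiff_clampAt (h b : ℝ) : ContDiff ℝ ∞ (clampAt h b) := by
  unfold clampAt
  exact contDiff_id.add ((contDiff_const.sub contDiff_id).mul
    (Real.smoothTransition.contDiff.comp
      (((contDiff_id.sub contDiff_const).div_const h).add contDiff_const)))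

theorem clampAt_of_le {h b t : ℝ} (hh : 0 < h) (ht : t ≤ b - h) : clampAt h b t = t := by
  have : (t - b) / h + 1 ≤ 0 := by
    have : (t - b) / h ≤ -1 := by rw [div_le_iff₀ hh]; linarith
    linarith
  rw [clampAt, Real.smoothTransition.zero_of_nonpos this, mul_zero, add_zero]

theorem clampAt_of_ge {h b t : ℝ} (hh : 0 < h) (ht : b ≤ t) : clampAt h b t = b := by
  have : 0 ≤ (t - b) / h := div_nonneg (by linarith) hh.le
  rw [clampAt, Real.smoothTransition.one_of_one_le (by linarith)]
  ring

theorem clampAt_mem_Icc {h b t : ℝ} (ht : t ≤ b) : clampAt h b t ∈ Icc t b := by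
  have h0 := Real.smoothTransition.nonneg ((t - b) / h + 1)
  have h1 := Real.smoothTransition.le_one ((t - b) / h + 1)
  unfold clampAt
  constructor <;> nlinarith

/-- For `b ≤ 1` the clock stops in time, and for `1 + h ≤ b` it is the identity on the interval. The
excluded range, where it could overshoot 1, does not occur when `b` and 1 are multiples of `h`. -/
theorem clampAt_mapsTo {h b : ℝ} (hh : 0 < h) (hb : 0 ≤ b) (hb' : b ≤ 1 ∨ 1 + h ≤ b) :
    MapsTo (clampAt h b) (Icc 0 1) (Icc 0 1) := by
  intro t ht
  rcases hb' with hb' | hb'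
  · rcases le_total t b with h1 | h1
    · have := clampAt_mem_Icc (h := h) h1
      exact ⟨ht.1.trans this.1, this.2.trans hb'⟩
    · rw [clampAt_of_ge hh h1]; exact ⟨hb, hb'⟩
  · rw [clampAt_of_le hh (by linarith [ht.2])]; exact ht

/-- Before `b - h` neither clock has begun to slow down; from then on both remain in a window of
length `2 * h`. -/
theorem clampAt_step {h b t : ℝ} (hh : 0 < h) :
    (clampAt h b t ∈ Icc (b - h) b ∧ clampAt h (b + h) t ∈ Icc (b - h) (b + h)) ∨
      ∀ᶠ s in 𝓝 t, clampAt h b s = clampAt h (b + h) s := by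
  rcases lt_or_ge t (b - h) with ht | ht
  · right
    filter_upwards [eventually_lt_nhds ht] with s hs
    rw [clampAt_of_le hh hs.le, clampAt_of_le hh (by linarith)]
  · left
    constructor
    · rcases le_total t b with h1 | h1
      · have := clampAt_mem_Icc (h := h) h1
        exact ⟨ht.trans this.1, this.2⟩
      · rw [clampAt_of_ge hh h1]; exact ⟨by linarith, le_rfl⟩
    · rcases le_total t (b + h) with h1 | h1
      · have := clampAt_mem_Icc (h := h) h1
        exact ⟨ht.trans this.1, this.2⟩
      · rw [clampAt_of_ge hh h1]; exact ⟨by linarith, le_rfl⟩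

theorem exists_isInvertibleMotion_clampAt [CompactSpace X] [T2Space X] (F : SmoothFoliation X n)
    {c : I → X} (hc : F.IsSmoothLeafPath c) {U : Set X} (hU : IsOpen U) (hcU : range c ⊆ U) :
    ∃ N : ℕ, 0 < N ∧ ∀ j : ℕ, j ≤ N + 1 → ∃ φ ψ : X × I → X, F.IsInvertibleMotion U φ ψ ∧
      ∀ t : I, φ (c 0, t) = c (projIcc 0 1 zero_le_one (clampAt (1 / N) (j / N) t)) := by
  choose O hOo hO hmove using F.exists_isInvertibleMotion_near hc hU hcU
  -- The step `h` is chosen below a Lebesgue number, so that the whole window around `j * h` lies in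
  -- one of the sets `O r`.
  obtain ⟨δ, hδ, hleb⟩ := lebesgue_number_lemma_of_metric (isCompact_Icc (a := (0 : ℝ)) (b := 1))
    hOo fun r _ => mem_iUnion.2 ⟨r, hO r⟩
  obtain ⟨N, hN⟩ := exists_nat_one_div_lt hδ
  refine ⟨N + 1, N.succ_pos, fun j => ?_⟩
  set h : ℝ := 1 / ((N + 1 : ℕ) : ℝ) with hh
  have hN0 : (0 : ℝ) < ((N + 1 : ℕ) : ℝ) := by positivity
  have hh0 : 0 < h := by positivity
  have hhδ : h < δ := by rw [hh]; push_cast; exact hN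
  have hj : ∀ j : ℕ, (j : ℝ) / ((N + 1 : ℕ) : ℝ) = j * h := fun j => by rw [hh]; ring
  have hNh : ((N + 1 : ℕ) : ℝ) * h = 1 := by rw [hh]; field_simp
  simp only [hj]
  induction j with
  | zero =>
    intro _
    refine ⟨_, _, IsInvertibleMotion.fst F U, fun t => ?_⟩
    rw [Nat.cast_zero, zero_mul, clampAt_of_ge hh0 t.2.1]
    exact congrArg c (projIcc_left (h := zero_le_one (α := ℝ))).symm
  | succ j ih =>
    intro hjN
    obtain ⟨φ, ψ, hφ, hφc⟩ := ih (by omega)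
    have hjh0 : (0 : ℝ) ≤ j * h := by positivity
    have hjh1 : (j : ℝ) * h ≤ 1 := by
      rw [← hNh]
      have : (j : ℝ) ≤ ((N + 1 : ℕ) : ℝ) := by exact_mod_cast (by omega : j ≤ N + 1)
      gcongr
    have hsucc : ((j + 1 : ℕ) : ℝ) * h = j * h + h := by push_cast; ring
    have hor : (j : ℝ) * h + h ≤ 1 ∨ 1 + h ≤ j * h + h := by
      rcases Nat.lt_or_ge j (N + 1) with h1 | h1
      · left
        rw [← hsucc, ← hNh]
        have : ((j + 1 : ℕ) : ℝ) ≤ ((N + 1 : ℕ) : ℝ) := by exact_mod_cast h1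
        gcongr
      · right
        have : ((N + 1 : ℕ) : ℝ) ≤ (j : ℝ) := by exact_mod_cast h1
        nlinarith
    obtain ⟨r, hr⟩ := hleb (j * h) ⟨hjh0, hjh1⟩
    have hsub : ∀ s ∈ Icc ((j : ℝ) * h - h) (j * h + h), s ∈ O r := by
      intro s hs
      refine hr ?_
      rw [Metric.mem_ball, Real.dist_eq, abs_lt]
      constructor <;> linarith [hs.1, hs.2]
    -- Both clocks read 0 at time 0, so the push starts at the identity. For `j = 0` the first clock
    -- is already stopped at 0.
    have hzero : clampAt h (j * h) 0 = clampAt h (j * h + h) 0 := by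
      rcases Nat.eq_zero_or_pos j with rfl | hj0
      · rw [Nat.cast_zero, zero_mul, zero_add, clampAt_of_ge hh0 le_rfl,
          clampAt_of_le hh0 (by linarith)]
      · have : (1 : ℝ) ≤ j := by exact_mod_cast hj0
        rw [clampAt_of_le hh0 (by nlinarith), clampAt_of_le hh0 (by linarith)]
    obtain ⟨φ', ψ', hφ', hφc'⟩ := hmove r (clampAt h (j * h)) (clampAt h (j * h + h))
      (contDiff_clampAt _ _) (contDiff_clampAt _ _) (clampAt_mapsTo hh0 hjh0 (Or.inl hjh1))
      (clampAt_mapsTo hh0 (by linarith) hor) hzero fun t _ => by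
        refine (clampAt_step hh0).imp (fun hst => ⟨hsub _ ⟨hst.1.1, ?_⟩, hsub _ hst.2⟩) id
        linarith [hst.1.2]
    refine ⟨_, _, hφ'.comp hφ, fun t => ?_⟩
    simp only [hsucc]
    rw [hφc, hφc']

end SmoothFoliation
end

theorem mainTheorem9 {X : Type u} [TopologicalSpace X] [PolishSpace X] [CompactSpace X]
    {n : ℕ} (F : SmoothFoliation X n) (L : Set X) (hL : F.IsLeaf L)
    (D : Set X) (hDL : D ⊆ L) (hDreg : F.IsRegularDomain D)
    (hDcpt : F.IsRelativelyCompactInLeaf D) (hDhol : F.WithoutHolonomy D)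
    (c : I → X) (hc : F.IsSmoothLeafPath c) (hcD : ∀ t, c t ∈ D)
    (U : Set X) (hU : IsOpen U) (hcU : range c ⊆ U) :
    ∃ φ : X × I → X, F.IsSmoothLeafwiseDiffeotopy φ ∧
      SmoothFoliation.diffeotopySupport φ ⊆ U ∧ ∀ t : I, φ (c 0, t) = c t := by
  obtain ⟨N, hN, hmotion⟩ := F.exists_isInvertibleMotion_clampAt hc hU hcU
  -- The extra step beyond `N` is needed: the clock stopping at 1 is slowed down before 1, whereas
  -- the one stopping at `1 + 1 / N` is the identity on the whole interval.
  obtain ⟨φ, ψ, hφ, hφc⟩ := hmotion (N + 1) le_rfl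
  have hN0 : (0 : ℝ) < N := by exact_mod_cast hN
  refine ⟨φ, hφ.motion.isSmoothLeafwiseDiffeotopy hφ.motion_inv hφ.left_inv hφ.right_inv hφ.zero,
    hφ.diffeotopySupport_subset, fun t => ?_⟩
  have ht : (t : ℝ) ≤ ((N + 1 : ℕ) : ℝ) / N - 1 / N := by
    have : ((N + 1 : ℕ) : ℝ) / N - 1 / N = 1 := by push_cast; field_simp; ring
    rw [this]; exact t.2.2
  rw [hφc, SmoothFoliation.clampAt_of_le (by positivity) ht, projIcc_val]
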